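/- Let $K$ be a field with a Hausdorff topology (for example $\mathbb{C}$ or $\mathbb{R}$, or a field of rational functions with the discrete topology), let $M\ge 0$, $N\ge 1$ and $0\le \ell\le N$ be integers, let $q\in K$ be nonzero and not a root of unity, and fix an $N$-th root $t=q^{1/N}\in K$ of $q$; for $x\in\frac1N\mathbb{Z}$ put $q^x=t^{Nx}$. For $k\ge 0$ write $(b)_k=\prod_{i=0}^{k-1}(1-bq^i)$, and let $\left[{A\atop B}\right]=\frac{(q)_A}{(q)_B(q)_{A-B}}$ if $0\le B\le A$ and $0$ otherwise. Let $\mathcal I$ be the $(N-1)\times(N-1)$ matrix with entries $\mathcal I_{j,k}=\delta_{j,k-1}+\delta_{j,k+1}$ (the incidence matrix of $A_{N-1}$), let $C=2I-\mathcal I$ be the Cartan matrix of $A_{N-1}$, and let $\vec{\rm e}_i$ be the vector with $(\vec{\rm e}_i)_j=\delta_{i,j}$ for $1\le j\le N-1$ (so $\vec{\rm e}_0=\vec{\rm e}_N=0$). For $N=1$ all vectors are empty and $(C^{-1}\vec n)_1$ is read as $0$. For $0\le L\le M$ put $$\delta^{(N)}_L=\frac{q^{L(L+\ell)/N}}{(q)_{M-L}}\sum_{\frac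 LN-(C^{-1}\vec n)_1\in\mathbb Z}q^{\vec n\,C^{-1}(\vec n-\vec{\rm e}_\ell)}\prod_{j=1}^{N-1}\left[{m_j+n_j\atop n_j}\right],$$ where the sum is over vectors $\vec n$ of non-negative integers $n_1,\dots,n_{N-1}$ for which the vector $\vec m$ determined by $$\vec m+\vec n=\tfrac12\bigl(\mathcal I\,\vec m+(2L+\ell)\,\vec{\rm e}_{N-1}+\vec{\rm e}_\ell\bigr)$$ also has non-negative integer entries, and put $\delta^{(N)}_L=0$ for $L>M$. For $0\le L\le M$ put $$\gamma^{(N)}_L=\frac{q^{L(L+\ell)/N}}{(q)_{M-L}(q^{\ell+1})_{M+L}}\sum_{\frac LN-(C^{-1}\vec\eta)_1\in\mathbb Z}q^{\vec\eta\,C^{-1}(\vec\eta-\vec{\rm e}_\ell)}\prod_{j=1}^{N-1}\left[{\mu_j+\eta_j\atop\eta_j}\right],$$ where the sum is over vectors $\vec\eta$ of non-negative integers for which the vector $\vec\mu$ determined by $$\vec\mu+\vec\eta=\tfrac12\bigl(\mathcal I\,\vec\mu+(M-L)\,\vec{\rm e}_1+(M+L+\ell)\,\vec{\rm e}_{N-1}+\vec{\rm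 e}_\ell\bigr)$$ also has non-negative integer entries, and put $\gamma^{(N)}_L=0$ for $L>M$. Then, with $a=q^\ell$, for every $L\ge 0$ $$\sum_{k=L}^{\infty}\frac{\delta^{(N)}_k}{(q)_{k-L}(aq)_{k+L}}=\gamma^{(N)}_L.$$ Moreover, for $N=1$ and $0\le L\le M$, $$\delta^{(1)}_L=\frac{q^{L^2}a^L}{(q)_{M-L}},\qquad \gamma^{(1)}_L=\frac{q^{L^2}a^L}{(q)_{M-L}(aq)_{M+L}},$$ and both are $0$ for $L>M$, which is Bailey's classical pair. -/

import Mathlib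

open scoped Matrix

namespace HLBailey

noncomputable section

/-- The `q`-shifted factorial `(a)_k = (1 - a) (1 - a q) ⋯ (1 - a q^(k-1))`. -/
def qPoch {K : Type*} [Field K] (q a : K) (k : ℕ) : K :=
  ∏ i ∈ Finset.range k, (1 - a * q ^ i)

/-- The Gaussian polynomial: `(q)_A / ((q)_B (q)_(A-B))` if `0 ≤ B ≤ A`, and `0` otherwise. -/
def qBinom {K : Type*} [Field K] (q : K) (A B : ℕ) : K :=
  if B ≤ A then qPoch q q A / (qPoch q q B * qPoch q q (A - B)) else 0

/-- The rational power `q ^ x` with respect to a chosen `N`-th root `t` of `q`, for rational `x`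
with `N x` an integer: `q ^ x = t ^ (N x)`. (It is used only for such `x`; the floor then does
nothing but turn the rational number `N x` into an integer.) -/
def qPow {K : Type*} [Field K] (t : K) (N : ℕ) (x : ℚ) : K :=
  t ^ ⌊(N : ℚ) * x⌋

/-- The incidence matrix of `A_{N-1}`. The entry of `Fin (N - 1)` with value `j` is the
coordinate number `j + 1` in the usual numbering by `1, …, N - 1`. -/
def incidence (N : ℕ) : Matrix (Fin (N - 1)) (Fin (N - 1)) ℚ :=
  Matrix.of fun j k => if (j : ℕ) + 1 = k ∨ (k : ℕ) + 1 = j then 1 else 0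

/-- The Cartan matrix `2 I - 𝓘` of `A_{N-1}`. -/
def cartan (N : ℕ) : Matrix (Fin (N - 1)) (Fin (N - 1)) ℚ :=
  2 - incidence N

/-- The vector `e_i`, with coordinates `(e_i)_j = δ_{i,j}` for `1 ≤ j ≤ N - 1`; it vanishes
for `i = 0` and for `i = N`. -/
def unitVec (N i : ℕ) : Fin (N - 1) → ℚ :=
  fun j => if (j : ℕ) + 1 = i then 1 else 0

/-- A vector of non-negative integers as a rational vector. -/
def toRat {r : ℕ} (v : Fin r → ℕ) : Fin r → ℚ := fun j => (v j : ℚ)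

/-- The system `m + n = (𝓘 m + s) / 2` with source vector `s`. -/
def IsSystem (N : ℕ) (s : Fin (N - 1) → ℚ) (m n : Fin (N - 1) → ℕ) : Prop :=
  toRat m + toRat n = (1 / 2 : ℚ) • (incidence N *ᵥ toRat m + s)

/-- The index set of the fermionic sum: pairs `(m, n)` of vectors of non-negative integers that
solve the system with source `s` and satisfy `L / N - (C⁻¹ n)_1 ∈ ℤ`, where `(C⁻¹ n)_1` is
written `e_1 ⬝ C⁻¹ n` (it is `0` when `N = 1`). The vector `m` is determined by `n`. -/
def fermionicIndex (N L : ℕ) (s : Fin (N - 1) → ℚ) :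
    Set ((Fin (N - 1) → ℕ) × (Fin (N - 1) → ℕ)) :=
  {p | IsSystem N s p.1 p.2 ∧
    ∃ z : ℤ, (L : ℚ) / N - unitVec N 1 ⬝ᵥ ((cartan N)⁻¹ *ᵥ toRat p.2) = z}

/-- The fermionic sum
`∑ q ^ (n C⁻¹ (n - e_ℓ)) ∏_{j=1}^{N-1} [m_j + n_j, n_j]` with source vector `s`. -/
def fermionicSum {K : Type*} [Field K] (q t : K) (N ℓ L : ℕ) (s : Fin (N - 1) → ℚ) : K :=
  ∑ᶠ p ∈ fermionicIndex N L s,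
    qPow t N (toRat p.2 ⬝ᵥ ((cartan N)⁻¹ *ᵥ (toRat p.2 - unitVec N ℓ))) *
      ∏ j, qBinom q (p.1 j + p.2 j) (p.2 j)

/-- The source `(2 L + ℓ) e_{N-1} + e_ℓ` of the `(m, n)`-system. -/
def sourceDelta (N ℓ L : ℕ) : Fin (N - 1) → ℚ :=
  (2 * (L : ℚ) + ℓ) • unitVec N (N - 1) + unitVec N ℓ

/-- The source `(M - L) e_1 + (M + L + ℓ) e_{N-1} + e_ℓ` of the `(μ, η)`-system. -/
def sourceGamma (M N ℓ L : ℕ) : Fin (N - 1) → ℚ :=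
  ((M : ℚ) - L) • unitVec N 1 + ((M : ℚ) + L + ℓ) • unitVec N (N - 1) + unitVec N ℓ

/-- The sequence `δ^(N)`. -/
def deltaSeq {K : Type*} [Field K] (q t : K) (M N ℓ L : ℕ) : K :=
  if L ≤ M then
    qPow t N ((L : ℚ) * (L + ℓ) / N) / qPoch q q (M - L) *
      fermionicSum q t N ℓ L (sourceDelta N ℓ L)
  else 0

/-- The sequence `γ^(N)`. -/
def gammaSeq {K : Type*} [Field K] (q t : K) (M N ℓ L : ℕ) : K :=
  if L ≤ M then
    qPow t N ((L : ℚ) * (L + ℓ) / N) /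
        (qPoch q q (M - L) * qPoch q (q ^ (ℓ + 1)) (M + L)) *
      fermionicSum q t N ℓ L (sourceGamma M N ℓ L)
  else 0

/-- The relation `γ_L = ∑_{k ≥ L} δ_k / ((q)_{k-L} (a q)_{k+L})` for all `L ≥ 0`. -/
def IsBaileyTransform {K : Type*} [Field K] [TopologicalSpace K] (q a : K) (δ γ : ℕ → K) : Prop :=
  ∀ L : ℕ, HasSum
    (fun k : Set.Ici L => δ k / (qPoch q q ((k : ℕ) - L) * qPoch q (a * q) ((k : ℕ) + L))) (γ L)

end

end HLBailey

namespace HLBailey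

lemma incidence_mulVec (N : ℕ) (g : ℕ → ℚ) (h0 : g 0 = 0) (hN : g N = 0) (k : Fin (N - 1)) :
    (incidence N *ᵥ fun j => g (j + 1)) k = g k + g (k + 2) := by
  have hk := k.2
  have e : ∀ j : Fin (N - 1), incidence N k j * g (j + 1)
      = (if (j : ℕ) = k + 1 then g (k + 2) else 0) + (if (j : ℕ) + 1 = k then g k else 0) := by
    intro j
    simp only [incidence, Matrix.of_apply]
    by_cases h1 : (j : ℕ) = k + 1
    · have h2 : ¬ ((j : ℕ) + 1 = k) := by omega
      rw [if_pos (Or.inl h1.symm), if_pos h1, if_neg h2, h1]; ring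
    · by_cases h2 : (j : ℕ) + 1 = k
      · simp [h2, h1]
      · have : ¬ ((k : ℕ) + 1 = j) := by omega
        simp [h1, h2, this]
  simp only [Matrix.mulVec, dotProduct, e, Finset.sum_add_distrib]
  rw [add_comm]
  congr 1
  · rcases Nat.eq_zero_or_pos (k : ℕ) with h | h
    · simp [h, h0]
    · rw [Finset.sum_eq_single (⟨k - 1, by omega⟩ : Fin (N - 1))]
      · rw [if_pos]; simp; omega
      · intro b _ hb
        rw [if_neg]; intro h'; apply hb; ext; simp; omega
      · simp
  · by_cases h : (k : ℕ) + 1 < N - 1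
    · rw [Finset.sum_eq_single (⟨k + 1, h⟩ : Fin (N - 1))]
      · simp
      · intro b _ hb
        rw [if_neg]; intro h'; apply hb; ext; simp; omega
      · simp
    · have : (k : ℕ) + 2 = N := by omega
      simp [this, hN]

/-- The standard formula `(C⁻¹)_{jk} = min (j, k) - j k / N`. In particular every entry of
`N C⁻¹` is an integer. -/
lemma cartan_inv (N : ℕ) : (cartan N)⁻¹ =
    Matrix.of fun j k : Fin (N - 1) => (min ((j : ℕ) + 1) ((k : ℕ) + 1) : ℕ) -
      (((j : ℕ) + 1 : ℕ) * ((k : ℕ) + 1 : ℕ) : ℚ) / N := by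
  apply Matrix.inv_eq_right_inv
  ext k i
  have hi := i.2
  have hk := k.2
  have hN : (N : ℚ) ≠ 0 := by norm_cast; omega
  have h := incidence_mulVec N
    (fun j => ((min j ((i : ℕ) + 1) : ℕ) : ℚ) - ((j : ℚ) * ((i : ℕ) + 1 : ℕ)) / N)
    (by simp) (by rw [min_eq_right (by omega)]; field_simp; simp) k
  rw [cartan, sub_mul, Matrix.sub_apply]
  have e1 : (incidence N * Matrix.of fun (j k : Fin (N - 1)) =>
      ((min ((j : ℕ) + 1) ((k : ℕ) + 1) : ℕ) : ℚ) -
      (((j : ℕ) + 1 : ℕ) * ((k : ℕ) + 1 : ℕ) : ℚ) / N) k i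
      = _ := h
  rw [e1, show (2 : Matrix (Fin (N - 1)) (Fin (N - 1)) ℚ) = 1 + 1 by norm_num, add_mul, one_mul,
    Matrix.add_apply, Matrix.of_apply, Matrix.one_apply]
  rcases lt_trichotomy (k : ℕ) i with hlt | heq | hgt
  · rw [if_neg (by intro h; rw [h] at hlt; omega), min_eq_left (by omega), min_eq_left (by omega),
      min_eq_left (by omega)]
    push_cast; ring
  · have : k = i := Fin.ext heq
    subst this
    rw [if_pos rfl, min_self, min_eq_left (by omega), min_eq_right (by omega)]
    push_cast; ring
  · rw [if_neg (by intro h; rw [h] at hgt; omega), min_eq_right (by omega),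
      min_eq_right (by omega), min_eq_right (by omega)]
    push_cast; ring

lemma incidence_transpose (N : ℕ) : (incidence N)ᵀ = incidence N := by
  ext j k
  simp only [incidence, Matrix.transpose_apply, Matrix.of_apply, or_comm]

/-- The fermionic sum is a finite sum. -/
lemma fermionicIndex_finite (N L : ℕ) (s : Fin (N - 1) → ℚ) : (fermionicIndex N L s).Finite := by
  set w : Fin (N - 1) → ℚ := fun j => ((j + 1 : ℕ) : ℚ) * (N - ((j + 1 : ℕ) : ℚ)) with hw
  have hw1 : ∀ j, 1 ≤ w j := by
    intro j
    have h2 : (1 : ℚ) ≤ N - ((j + 1 : ℕ) : ℚ) := by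
      have : ((j : ℕ) + 1) + 1 ≤ N := by have := j.2; omega
      have : (((j : ℕ) + 1 + 1 : ℕ) : ℚ) ≤ N := by exact_mod_cast this
      push_cast at this ⊢; linarith
    have h1 : (1 : ℚ) ≤ ((j + 1 : ℕ) : ℚ) := by push_cast; linarith [(Nat.cast_nonneg (j : ℕ) : (0 : ℚ) ≤ _)]
    simp only [hw]; nlinarith
  have hI : ∀ k, (incidence N *ᵥ w) k = 2 * w k - 2 := by
    intro k
    have := incidence_mulVec N (fun j => (j : ℚ) * (N - (j : ℚ))) (by simp) (by simp) k
    simp only [hw]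
    rw [this]; push_cast; ring
  have key : ∀ p ∈ fermionicIndex N L s, ∀ j, (p.1 j : ℚ) + p.2 j ≤ w ⬝ᵥ s := by
    rintro ⟨m, n⟩ ⟨h, -⟩ j
    simp only at h ⊢
    have h1 : w ⬝ᵥ (toRat m + toRat n) = w ⬝ᵥ ((1 / 2 : ℚ) • (incidence N *ᵥ toRat m + s)) :=
      congrArg _ h
    rw [dotProduct_smul, dotProduct_add, dotProduct_add, Matrix.dotProduct_mulVec,
      ← Matrix.mulVec_transpose, incidence_transpose] at h1
    have h2 : (incidence N *ᵥ w) ⬝ᵥ toRat m = 2 * (w ⬝ᵥ toRat m) - 2 * ∑ i, (m i : ℚ) := by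
      simp only [dotProduct, hI, toRat, Finset.mul_sum, ← Finset.sum_sub_distrib]
      exact Finset.sum_congr rfl fun i _ => by ring
    rw [h2, smul_eq_mul] at h1
    have h3 : (m j : ℚ) ≤ ∑ i, (m i : ℚ) :=
      Finset.single_le_sum (f := fun i => (m i : ℚ)) (fun i _ => Nat.cast_nonneg _)
        (Finset.mem_univ j)
    have h5 : ∀ i, (0 : ℚ) ≤ w i * n i := fun i =>
      mul_nonneg (by linarith [hw1 i]) (Nat.cast_nonneg _)
    have h4 : w j * n j ≤ w ⬝ᵥ toRat n :=
      Finset.single_le_sum (f := fun i => w i * (n i : ℚ)) (fun i _ => h5 i) (Finset.mem_univ j)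
    have h6 : (n j : ℚ) ≤ w j * n j := le_mul_of_one_le_left (Nat.cast_nonneg _) (hw1 j)
    have h7 := (Nat.cast_nonneg (m j) : (0 : ℚ) ≤ _)
    have h8 := (Nat.cast_nonneg (n j) : (0 : ℚ) ≤ _)
    linarith
  refine Set.Finite.subset
    (((Set.Finite.pi fun _ : Fin (N - 1) => Set.finite_Iic ⌊w ⬝ᵥ s⌋₊).prod
      (Set.Finite.pi fun _ : Fin (N - 1) => Set.finite_Iic ⌊w ⬝ᵥ s⌋₊))) ?_
  intro p hp
  refine ⟨fun j _ => ?_, fun j _ => ?_⟩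
  · exact Nat.le_floor (by linarith [key p hp j, (Nat.cast_nonneg (p.2 j) : (0 : ℚ) ≤ _)])
  · exact Nat.le_floor (by linarith [key p hp j, (Nat.cast_nonneg (p.1 j) : (0 : ℚ) ≤ _)])

end HLBailey

/-! Take an integer sequence `a_0 ≤ … ≤ a_{N-1}` as the summation variable, with `n_j = a_j -
a_{j-1}` and `m_j = A + ∑_{i<j} (2 a_i + ε_i)`, where `ε` is `ℓ` ones followed by zeros. Summation
by parts gives `n C⁻¹ (n - e_ℓ) + L (L + ℓ) / N = ∑ a_i (a_i + ε_i)`, and the congruence condition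
says that `a_0` is an integer. Hence the numerators of `δ_L` and `γ_L` are the values `F(0, 2L+ℓ)`
and `F(M-L, M+L+ℓ)` of a single function `F(A, B)` of the boundary values `m_0 = A`, `m_N = B`
(`chainTotal`, `qPow_mul_fermionicSum`).

The function satisfies `F(A+1,B) + (1-q^A) F(A-1,B) = F(A,B+1) + (1-q^B) F(A,B-1)`
(`chainTotal_relation`), as does any linear functional of `H_A H_B` for the continuous `q`-Hermite
polynomials, where `2x H_n = H_{n+1} + (1-q^n) H_{n-1}`. So `F` is determined by `F(0, ·)` through
their linearization formula (`eq_sum_hermiteCoeff`). At `A = M-L`, `B = M+L+ℓ`, with `k` replaced by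
`M-k`, that formula is the Bailey relation multiplied by `(q)_{M-L} (aq)_{M+L}`.

The recurrence itself follows from a refinement that fixes the last entry of the sequence and is
proved by induction on the length with the `q`-Pascal rule (`chainSum_relation`). -/

namespace HLBailey

/-! ### Gaussian polynomials and the `q`-Pascal rule. -/

variable {K : Type*} [Field K]

lemma qPoch_succ (q a : K) (k : ℕ) : qPoch q a (k + 1) = qPoch q a k * (1 - a * q ^ k) :=
  Finset.prod_range_succ _ _

lemma qPoch_self_ne_zero {q : K} (hq : ∀ j : ℕ, 1 ≤ j → q ^ j ≠ 1) (k : ℕ) : qPoch q q k ≠ 0 := by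
  refine Finset.prod_ne_zero_iff.2 fun i _ => ?_
  rw [← pow_succ']
  exact sub_ne_zero.2 (hq (i + 1) (by omega)).symm

lemma qPoch_add (q a : K) (m n : ℕ) : qPoch q a (m + n) = qPoch q a m * qPoch q (a * q ^ m) n := by
  simp only [qPoch, Finset.prod_range_add, pow_add, mul_assoc]

lemma qBinom_add (q : K) (m h : ℕ) :
    qBinom q (m + h) h = qPoch q q (m + h) / (qPoch q q h * qPoch q q m) := by
  simp [qBinom]

lemma qBinom_pascal {q : K} (hq : ∀ j : ℕ, 1 ≤ j → q ^ j ≠ 1) (m h : ℕ) :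
    qBinom q (m + 1 + (h + 1)) (h + 1) =
      qBinom q (m + (h + 1)) (h + 1) + q ^ (m + 1) * qBinom q (m + 1 + h) h := by
  have h0 := qPoch_self_ne_zero hq
  have h1 := h0 (m + 1)
  have h2 := h0 (h + 1)
  rw [qBinom_add, qBinom_add, qBinom_add, show m + 1 + (h + 1) = m + h + 1 + 1 by ring,
    show m + (h + 1) = m + h + 1 by ring, show m + 1 + h = m + h + 1 by ring]
  rw [qPoch_succ] at h1 h2
  rw [qPoch_succ q q (m + h + 1), qPoch_succ q q m, qPoch_succ q q h]
  have hm := left_ne_zero_of_mul h1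
  have hm' := right_ne_zero_of_mul h1
  have hh := left_ne_zero_of_mul h2
  have hh' := right_ne_zero_of_mul h2
  field_simp
  ring

/-- The Gaussian polynomial `[m + h, h]` for integers `m`, `h`, read as `0` unless both are
non-negative. -/
noncomputable def gaussInt (q : K) (m h : ℤ) : K :=
  if 0 ≤ m ∧ 0 ≤ h then qBinom q (m + h).toNat h.toNat else 0

lemma gaussInt_natCast (q : K) (m h : ℕ) : gaussInt q m h = qBinom q (m + h) h := by
  rw [gaussInt, if_pos ⟨Int.natCast_nonneg m, Int.natCast_nonneg h⟩, ← Nat.cast_add,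
    Int.toNat_natCast, Int.toNat_natCast]

lemma gaussInt_of_neg_left (q : K) {m : ℤ} (hm : m < 0) (h : ℤ) : gaussInt q m h = 0 :=
  if_neg fun hh => absurd hh.1 (by omega)

lemma gaussInt_of_neg_right (q : K) (m : ℤ) {h : ℤ} (hh : h < 0) : gaussInt q m h = 0 :=
  if_neg fun h' => absurd h'.2 (by omega)

lemma gaussInt_zero_right {q : K} (hq : ∀ j : ℕ, 1 ≤ j → q ^ j ≠ 1) {m : ℤ} (hm : 0 ≤ m) :
    gaussInt q m 0 = 1 := by
  lift m to ℕ using hm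
  have := gaussInt_natCast q m 0
  rw [Nat.cast_zero, qBinom_add] at this
  rw [this]
  simpa [qPoch] using div_self (qPoch_self_ne_zero hq m)

lemma gaussInt_zero_left {q : K} (hq : ∀ j : ℕ, 1 ≤ j → q ^ j ≠ 1) {h : ℤ} (hh : 0 ≤ h) :
    gaussInt q 0 h = 1 := by
  lift h to ℕ using hh
  have := gaussInt_natCast q 0 h
  rw [Nat.cast_zero, qBinom_add] at this
  rw [this]
  simpa [qPoch] using div_self (qPoch_self_ne_zero hq h)

lemma gaussInt_pascal {q : K} (hq : ∀ j : ℕ, 1 ≤ j → q ^ j ≠ 1) {m : ℤ} (hm : 0 ≤ m) (h : ℤ) :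
    gaussInt q m h = gaussInt q (m + 1) h - q ^ (m + 1) * gaussInt q (m + 1) (h - 1) := by
  rcases lt_trichotomy h 0 with h0 | rfl | h0
  · simp [gaussInt_of_neg_right q _ h0, gaussInt_of_neg_right q _ (show h - 1 < 0 by omega)]
  · rw [gaussInt_zero_right hq hm, gaussInt_zero_right hq (by omega),
      gaussInt_of_neg_right q _ (by omega)]
    simp
  · obtain ⟨k, rfl⟩ : ∃ k : ℕ, h = (k + 1 : ℕ) := ⟨(h - 1).toNat, by omega⟩
    lift m to ℕ using hm
    have e1 := gaussInt_natCast q m (k + 1)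
    have e2 := gaussInt_natCast q (m + 1) (k + 1)
    have e3 := gaussInt_natCast q (m + 1) k
    rw [qBinom_pascal hq, ← e1, ← e3] at e2
    have e4 : ((k + 1 : ℕ) : ℤ) - 1 = k := by push_cast; ring
    have e5 : q ^ ((m : ℤ) + 1) = q ^ (m + 1) := by exact_mod_cast zpow_natCast q (m + 1)
    rw [e4, e5]
    push_cast at e2 ⊢
    rw [e2]
    ring

/-- Replaces the Pascal rule at `m = -1`, where it fails by a delta at `h = 0`. That term is always
met by a vanishing `chainSum`. -/
lemma gaussInt_zero_left_sub {q : K} (hq : ∀ j : ℕ, 1 ≤ j → q ^ j ≠ 1) (h : ℤ) :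
    gaussInt q 0 h - gaussInt q 0 (h - 1) = if h = 0 then 1 else 0 := by
  rcases lt_trichotomy h 0 with h0 | rfl | h0
  · simp [gaussInt_of_neg_right q _ h0, gaussInt_of_neg_right q _ (show h - 1 < 0 by omega), h0.ne]
  · rw [gaussInt_zero_left hq le_rfl, gaussInt_of_neg_right q _ (by omega)]
    simp
  · rw [gaussInt_zero_left hq h0.le, gaussInt_zero_left hq (by omega)]
    simp [h0.ne']

/-- The generating function of integer sequences `a_0 ≤ ⋯ ≤ a_n = x` with entries in `[-c, c]`:
with partial sums `μ_j = A + ∑_{i < j} (2 a_i + ε_i)` satisfying `μ_{n+1} = B`, the weight is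
`q ^ (∑ a_i (a_i + ε_i)) ∏_{j=1}^n [μ_j + a_j - a_{j-1}, μ_j]`. -/
noncomputable def chainSum (q : K) (ε : ℕ → ℤ) (c : ℤ) : ℕ → ℤ → ℤ → ℤ → K
  | 0, A, B, x => if B = A + 2 * x + ε 0 then q ^ (x * (x + ε 0)) else 0
  | n + 1, A, B, x => q ^ (x * (x + ε (n + 1))) *
      ∑ y ∈ Finset.Icc (-c) c, chainSum q ε c n A (B - 2 * x - ε (n + 1)) y *
        gaussInt q (B - 2 * x - ε (n + 1)) (x - y)

/-! ### The recurrence for chain generating functions. -/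

section chainSum

variable {q : K} {ε : ℕ → ℤ} {c : ℤ}

lemma chainSum_succ_of_neg (n : ℕ) (A : ℤ) {B x : ℤ} (h : B - 2 * x - ε (n + 1) < 0) :
    chainSum q ε c (n + 1) A B x = 0 := by
  simp [chainSum, gaussInt_of_neg_left q h]

/-- The first partial sum `A + 2 a_0 + ε_0` must be at least `-1`, which bounds `a_0` below, and the
later entries are no smaller. The value `B = -1` is allowed because the recurrence lowers `B = 0`.
-/
lemma chainSum_eq_zero_of_lt (hε1 : ∀ i, ε i ≤ 1) (n : ℕ) {A B x : ℤ} (hA : 0 ≤ A) (hB : -1 ≤ B)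
    (hx : x < -(A + 2)) : chainSum q ε c n A B x = 0 := by
  induction n generalizing B x with
  | zero =>
    have := hε1 0
    exact if_neg (by omega)
  | succ n ih =>
    rw [chainSum, Finset.sum_eq_zero, mul_zero]
    intro y _
    rcases lt_or_ge (B - 2 * x - ε (n + 1)) 0 with h | h
    · rw [gaussInt_of_neg_left q h, mul_zero]
    · rcases lt_or_ge x y with h' | h'
      · rw [gaussInt_of_neg_right q _ (by omega), mul_zero]
      · rw [ih (by omega) (by omega), zero_mul]

/-- The last step `2 x + ε_n` equals `B` minus a non-negative partial sum. -/
lemma chainSum_eq_zero_of_lt_two_mul (n : ℕ) {A B x : ℤ} (hA : 0 ≤ A) (hx : B < 2 * x + ε n) :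
    chainSum q ε c n A B x = 0 := by
  cases n with
  | zero => exact if_neg (by omega)
  | succ n => exact chainSum_succ_of_neg n A (by omega)

lemma sum_Icc_sub_one {f : ℤ → K} {a b : ℤ} (h0 : f (a - 1) = 0) (h1 : f b = 0) :
    ∑ x ∈ Finset.Icc a b, f (x - 1) = ∑ x ∈ Finset.Icc a b, f x := by
  rcases lt_or_ge b a with h | h
  · simp [Finset.Icc_eq_empty_of_lt h]
  have e : ∑ x ∈ Finset.Icc a b, f (x - 1) = ∑ x ∈ Finset.Icc (a - 1) (b - 1), f x := by
    refine Finset.sum_nbij' (fun x => x - 1) (fun x => x + 1) ?_ ?_ ?_ ?_ ?_ <;> simp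
  rw [e]
  have e1 : Finset.Icc (a - 1) (b - 1) = insert (a - 1) (Finset.Icc a (b - 1)) := by
    ext; simp; omega
  have e2 : Finset.Icc a b = insert b (Finset.Icc a (b - 1)) := by
    ext; simp; omega
  rw [e1, e2, Finset.sum_insert (by simp), Finset.sum_insert (by simp), h0, h1]

/-- The induction step of `chainSum_relation` without its common power of `q`; here `B` is the
partial sum just before the last entry `x`. Each Gaussian factor is adjusted to its own partial sum
by the Pascal rule. -/
lemma sum_gaussInt_relation (hq : ∀ j : ℕ, 1 ≤ j → q ^ j ≠ 1)
    (hε0 : ∀ i, 0 ≤ ε i) (hε1 : ∀ i, ε i ≤ 1) (n : ℕ) {A B x : ℤ} (hA : 0 ≤ A)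
    (hAc : A + 2 ≤ c) (hB : 0 ≤ B) (hx : x ≤ c) (hBx : 0 < B ∨ 0 ≤ x)
    (h : ∀ y ≤ c, chainSum q ε c n (A + 1) B y + (1 - q ^ A) * chainSum q ε c n (A - 1) B y =
      chainSum q ε c n A (B + 1) y + chainSum q ε c n A (B - 1) y -
        q ^ B * chainSum q ε c n A (B - 1) (y - 1)) :
    ∑ y ∈ Finset.Icc (-c) c, chainSum q ε c n (A + 1) B y * gaussInt q B (x - y) +
      (1 - q ^ A) * ∑ y ∈ Finset.Icc (-c) c, chainSum q ε c n (A - 1) B y * gaussInt q B (x - y) =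
    ∑ y ∈ Finset.Icc (-c) c, chainSum q ε c n A (B + 1) y * gaussInt q (B + 1) (x - y) -
      q ^ (B + 1) *
        ∑ y ∈ Finset.Icc (-c) c, chainSum q ε c n A (B + 1) y * gaussInt q (B + 1) (x - 1 - y) +
      ∑ y ∈ Finset.Icc (-c) c, chainSum q ε c n A (B - 1) y * gaussInt q (B - 1) (x - y) := by
  have shift : ∑ y ∈ Finset.Icc (-c) c, chainSum q ε c n A (B - 1) (y - 1) * gaussInt q B (x - y) =
      ∑ y ∈ Finset.Icc (-c) c, chainSum q ε c n A (B - 1) y * gaussInt q B (x - 1 - y) := by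
    rw [← sum_Icc_sub_one (f := fun y => chainSum q ε c n A (B - 1) y * gaussInt q B (x - 1 - y))]
    · exact Finset.sum_congr rfl fun y _ => by rw [show x - 1 - (y - 1) = x - y by ring]
    · rw [chainSum_eq_zero_of_lt hε1 n hA (by omega) (by omega), zero_mul]
    · rw [gaussInt_of_neg_right q _ (by omega), mul_zero]
  have low : ∑ y ∈ Finset.Icc (-c) c, chainSum q ε c n A (B - 1) y * gaussInt q B (x - y) -
      q ^ B * ∑ y ∈ Finset.Icc (-c) c, chainSum q ε c n A (B - 1) y * gaussInt q B (x - 1 - y) =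
      ∑ y ∈ Finset.Icc (-c) c, chainSum q ε c n A (B - 1) y * gaussInt q (B - 1) (x - y) := by
    rw [Finset.mul_sum, ← Finset.sum_sub_distrib]
    rcases hB.lt_or_eq with hB | rfl
    · refine Finset.sum_congr rfl fun y _ => ?_
      rw [gaussInt_pascal hq (show 0 ≤ B - 1 by omega), show x - 1 - y = x - y - 1 by ring]
      simp only [sub_add_cancel]
      ring
    -- At `B = 0` only `y = x` could contribute, and `0 ≤ x` makes its coefficient vanish.
    · rw [Finset.sum_eq_zero, Finset.sum_eq_zero]
      · intro y _
        rw [gaussInt_of_neg_left q (by omega), mul_zero]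
      · intro y _
        rw [show x - 1 - y = x - y - 1 by ring, zpow_zero, one_mul, ← mul_sub,
          gaussInt_zero_left_sub hq]
        split_ifs with hy
        · have := hε0 n
          rw [chainSum_eq_zero_of_lt_two_mul n hA (by omega), zero_mul]
        · simp
  have high : ∑ y ∈ Finset.Icc (-c) c, chainSum q ε c n A (B + 1) y * gaussInt q B (x - y) =
      ∑ y ∈ Finset.Icc (-c) c, chainSum q ε c n A (B + 1) y * gaussInt q (B + 1) (x - y) -
      q ^ (B + 1) *
        ∑ y ∈ Finset.Icc (-c) c, chainSum q ε c n A (B + 1) y * gaussInt q (B + 1) (x - 1 - y) := by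
    rw [Finset.mul_sum, ← Finset.sum_sub_distrib]
    refine Finset.sum_congr rfl fun y _ => ?_
    rw [gaussInt_pascal hq hB, show x - 1 - y = x - y - 1 by ring]
    ring
  rw [← low, ← shift, ← high, Finset.mul_sum, Finset.mul_sum, ← Finset.sum_add_distrib,
    ← Finset.sum_sub_distrib, ← Finset.sum_add_distrib]
  refine Finset.sum_congr rfl fun y hy => ?_
  linear_combination gaussInt q B (x - y) * h y (Finset.mem_Icc.1 hy).2

/-- The term at `x - 1` makes the recurrence hold for each last entry separately; summing over `x`
removes the shift and produces the factor `1 - q ^ B`. -/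
theorem chainSum_relation (hq0 : q ≠ 0) (hq : ∀ j : ℕ, 1 ≤ j → q ^ j ≠ 1)
    (hε0 : ∀ i, 0 ≤ ε i) (hε1 : ∀ i, ε i ≤ 1) (hε : ∀ i, ε (i + 1) ≤ ε i)
    {A : ℤ} (hA : 0 ≤ A) (hAc : A + 2 ≤ c) (n : ℕ) {B x : ℤ} (hB : 0 ≤ B) (hx : x ≤ c) :
    chainSum q ε c n (A + 1) B x + (1 - q ^ A) * chainSum q ε c n (A - 1) B x =
      chainSum q ε c n A (B + 1) x + chainSum q ε c n A (B - 1) x -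
        q ^ B * chainSum q ε c n A (B - 1) (x - 1) := by
  induction n generalizing B x with
  | zero =>
    simp only [chainSum]
    by_cases h1 : B = A + 1 + 2 * x + ε 0
    · rw [if_pos h1, if_neg (by omega), if_neg (by omega), if_pos (by omega), if_neg (by omega)]
      ring
    by_cases h2 : B = A - 1 + 2 * x + ε 0
    · rw [if_neg h1, if_pos h2, if_pos (by omega), if_neg (by omega), if_pos (by omega),
        ← zpow_add₀ hq0, sub_mul, ← zpow_add₀ hq0, h2]
      ring_nf
    · rw [if_neg h1, if_neg h2, if_neg (by omega), if_neg (by omega), if_neg (by omega)]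
      ring
  | succ n ih =>
    have e0 := hε0 (n + 1)
    have e1 := hε1 (n + 1)
    have e2 := hε n
    -- Passing from `x` to `x - 1` changes the exponent by `1 - 2 x - ε`, so the factor `q ^ B`
    -- becomes exactly the power of `q` in the Pascal rule.
    have hexp : q ^ B * q ^ ((x - 1) * (x - 1 + ε (n + 1))) =
        q ^ (x * (x + ε (n + 1))) * q ^ (B - 2 * x - ε (n + 1) + 1) := by
      rw [← zpow_add₀ hq0, ← zpow_add₀ hq0]
      ring_nf
    rcases lt_or_ge (B - 2 * x - ε (n + 1)) 0 with h | h
    · rw [chainSum_succ_of_neg n (A + 1) h, chainSum_succ_of_neg n (A - 1) h,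
        chainSum_succ_of_neg n A (show B - 1 - 2 * x - ε (n + 1) < 0 by omega)]
      -- At partial sum `-1` two terms survive, both with partial sum `0`, and they must cancel.
      by_cases h' : B - 2 * x - ε (n + 1) = -1
      · simp only [chainSum]
        rw [show B + 1 - 2 * x - ε (n + 1) = 0 by omega,
          show B - 1 - 2 * (x - 1) - ε (n + 1) = 0 by omega, ← mul_assoc, hexp, h']
        have key : ∑ y ∈ Finset.Icc (-c) c, chainSum q ε c n A 0 y * gaussInt q 0 (x - y) -
            ∑ y ∈ Finset.Icc (-c) c, chainSum q ε c n A 0 y * gaussInt q 0 (x - 1 - y) = 0 := by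
          rw [← Finset.sum_sub_distrib]
          refine Finset.sum_eq_zero fun y _ => ?_
          rw [show x - 1 - y = x - y - 1 by ring, ← mul_sub, gaussInt_zero_left_sub hq]
          split_ifs with hy
          -- From `B ≥ 0`, `2 x + ε (n + 1) = B + 1 ≥ 1`, hence `2 x + ε n ≥ 1` because `ε` is
          -- decreasing.
          · rw [chainSum_eq_zero_of_lt_two_mul n hA (by omega), zero_mul]
          · simp
        simp only [neg_add_cancel, zpow_zero]
        linear_combination -q ^ (x * (x + ε (n + 1))) * key
      · rw [chainSum_succ_of_neg n A (show B + 1 - 2 * x - ε (n + 1) < 0 by omega),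
          chainSum_succ_of_neg n A (show B - 1 - 2 * (x - 1) - ε (n + 1) < 0 by omega)]
        ring
    · have key := sum_gaussInt_relation hq hε0 hε1 n hA hAc h hx (by omega) fun y hy => ih h hy
      simp only [chainSum]
      rw [show B + 1 - 2 * x - ε (n + 1) = B - 2 * x - ε (n + 1) + 1 by ring,
        show B - 1 - 2 * x - ε (n + 1) = B - 2 * x - ε (n + 1) - 1 by ring,
        show B - 1 - 2 * (x - 1) - ε (n + 1) = B - 2 * x - ε (n + 1) + 1 by ring,
        ← mul_assoc (q ^ B), hexp]
      linear_combination q ^ (x * (x + ε (n + 1))) * key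

/-- The generating function of all sequences `a_0 ≤ ⋯ ≤ a_n`. -/
noncomputable def chainTotal (q : K) (ε : ℕ → ℤ) (c : ℤ) (n : ℕ) (A B : ℤ) : K :=
  ∑ x ∈ Finset.Icc (-c) c, chainSum q ε c n A B x

/-- The recurrence of the continuous `q`-Hermite polynomials, in both arguments. -/
theorem chainTotal_relation (hq0 : q ≠ 0) (hq : ∀ j : ℕ, 1 ≤ j → q ^ j ≠ 1)
    (hε0 : ∀ i, 0 ≤ ε i) (hε1 : ∀ i, ε i ≤ 1) (hε : ∀ i, ε (i + 1) ≤ ε i) (n : ℕ)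
    {A B : ℤ} (hA : 0 ≤ A) (hAc : A + 2 ≤ c) (hB : 0 ≤ B) (hBc : B ≤ c) :
    chainTotal q ε c n (A + 1) B + (1 - q ^ A) * chainTotal q ε c n (A - 1) B =
      chainTotal q ε c n A (B + 1) + (1 - q ^ B) * chainTotal q ε c n A (B - 1) := by
  have e0 := hε0 n
  -- The cutoff `c` is large enough that nothing is lost at either end of the interval.
  have shift : ∑ x ∈ Finset.Icc (-c) c, chainSum q ε c n A (B - 1) (x - 1) =
      ∑ x ∈ Finset.Icc (-c) c, chainSum q ε c n A (B - 1) x :=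
    sum_Icc_sub_one (chainSum_eq_zero_of_lt hε1 n hA (by omega) (by omega))
      (chainSum_eq_zero_of_lt_two_mul n hA (by omega))
  have := Finset.sum_congr rfl fun x (hx : x ∈ Finset.Icc (-c) c) =>
    chainSum_relation hq0 hq hε0 hε1 hε hA hAc n hB (Finset.mem_Icc.1 hx).2
  simp only [Finset.sum_add_distrib, Finset.sum_sub_distrib, ← Finset.mul_sum] at this
  rw [shift] at this
  simp only [chainTotal]
  linear_combination this

end chainSum

/-! ### Linearization from the `q`-Hermite recurrence. -/

section linearization

/-- The product `(1 - q^n) (1 - q^(n-1)) ⋯ (1 - q^(n-k+1))`. -/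
def qDescPoch (q : K) (n k : ℕ) : K := ∏ i ∈ Finset.range k, (1 - q ^ n / q ^ i)

lemma qDescPoch_succ (q : K) (n k : ℕ) :
    qDescPoch q n (k + 1) = qDescPoch q n k * (1 - q ^ n / q ^ k) :=
  Finset.prod_range_succ _ _

lemma qDescPoch_succ_succ {q : K} (hq0 : q ≠ 0) (n k : ℕ) :
    qDescPoch q (n + 1) (k + 1) = (1 - q ^ (n + 1)) * qDescPoch q n k := by
  rw [qDescPoch, Finset.prod_range_succ', mul_comm, pow_zero, div_one]
  congr 1
  refine Finset.prod_congr rfl fun i _ => ?_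
  rw [pow_succ, pow_succ, mul_div_mul_right _ _ hq0]

/-- The truncated `n - 1` at `n = 0` is harmless because `1 - q ^ 0 = 0`. -/
lemma one_sub_pow_mul_qDescPoch {q : K} (hq0 : q ≠ 0) (n k : ℕ) :
    (1 - q ^ n) * qDescPoch q (n - 1) k = qDescPoch q n (k + 1) := by
  cases n with
  | zero => simp [qDescPoch, Finset.prod_range_succ']
  | succ n => rw [qDescPoch_succ_succ hq0, Nat.add_sub_cancel]

lemma qDescPoch_eq_zero {q : K} (hq0 : q ≠ 0) {n k : ℕ} (h : n < k) : qDescPoch q n k = 0 :=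
  Finset.prod_eq_zero (Finset.mem_range.2 h) (by rw [div_self (pow_ne_zero _ hq0), sub_self])

lemma qDescPoch_add_mul {q : K} (hq0 : q ≠ 0) (m k : ℕ) :
    qDescPoch q (m + k) k * qPoch q q m = qPoch q q (m + k) := by
  induction k with
  | zero => simp [qDescPoch]
  | succ k ih =>
    rw [← add_assoc, qDescPoch_succ_succ hq0, qPoch_succ, ← ih]
    ring

/-- The linearization coefficient `(q)_A (q)_B / ((q)_k (q)_{A-k} (q)_{B-k})` of the continuous
`q`-Hermite polynomials. -/
def hermiteCoeff (q : K) (A B k : ℕ) : K :=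
  qDescPoch q A k * qDescPoch q B k / qPoch q q k

/-- Absorbing `1 - q ^ A` and `1 - q ^ B` makes all four terms multiples of `qDescPoch q A k *
qDescPoch q B k`. -/
lemma hermiteCoeff_relation {q : K} (hq0 : q ≠ 0) (hq : ∀ j : ℕ, 1 ≤ j → q ^ j ≠ 1) (A B k : ℕ) :
    hermiteCoeff q (A + 1) B (k + 1) + (1 - q ^ A) * hermiteCoeff q (A - 1) B k =
      hermiteCoeff q A (B + 1) (k + 1) + (1 - q ^ B) * hermiteCoeff q A (B - 1) k := by
  have h := qPoch_self_ne_zero hq (k + 1)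
  have e : ∀ A B, (1 - q ^ A) * hermiteCoeff q (A - 1) B k =
      qDescPoch q A (k + 1) * qDescPoch q B k / qPoch q q k := by
    intro A B
    rw [hermiteCoeff, ← one_sub_pow_mul_qDescPoch hq0]
    ring
  have e' : (1 - q ^ B) * hermiteCoeff q A (B - 1) k =
      qDescPoch q B (k + 1) * qDescPoch q A k / qPoch q q k := by
    rw [← e, hermiteCoeff, hermiteCoeff]
    ring
  rw [e, e', hermiteCoeff, hermiteCoeff, qDescPoch_succ_succ hq0, qDescPoch_succ_succ hq0,
    qDescPoch_succ, qDescPoch_succ]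
  rw [qPoch_succ, ← pow_succ'] at h ⊢
  have h1 := left_ne_zero_of_mul h
  have h2 := right_ne_zero_of_mul h
  field_simp
  ring

lemma hermiteCoeff_zero_right (q : K) (A B : ℕ) : hermiteCoeff q A B 0 = 1 := by
  simp [hermiteCoeff, qDescPoch, qPoch]

/-- The recurrence raises `A` by one, and the coefficients obey the same recurrence. The bound `S`
allows for a recurrence valid only below a cutoff; the free length `n` lets the three sums be
aligned, since coefficients with `k > A` vanish. -/
theorem eq_sum_hermiteCoeff {q : K} (hq0 : q ≠ 0) (hq : ∀ j : ℕ, 1 ≤ j → q ^ j ≠ 1)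
    {S : ℕ} {g : ℕ → ℕ → K}
    (hg : ∀ A B, A + B + 1 ≤ S → g (A + 1) B + (1 - q ^ A) * g (A - 1) B =
      g A (B + 1) + (1 - q ^ B) * g A (B - 1))
    (A : ℕ) : ∀ B n : ℕ, A + B ≤ S → A < n →
      g A B = ∑ k ∈ Finset.range n, hermiteCoeff q A B k * g 0 (A + B - 2 * k) := by
  induction A using Nat.strong_induction_on with
  | _ A ih =>
  intro B n hS hn
  cases A with
  | zero =>
    rw [Finset.sum_eq_single_of_mem 0 (Finset.mem_range.2 hn)]
    · simp [hermiteCoeff_zero_right]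
    · intro k _ hk
      rw [hermiteCoeff, qDescPoch_eq_zero hq0 (Nat.pos_of_ne_zero hk)]
      simp
  | succ A =>
    obtain ⟨n, rfl⟩ : ∃ m, n = m + 1 := ⟨n - 1, by omega⟩
    have h1 := ih A (by omega) (B + 1) (n + 1) (by omega) (by omega)
    have h2 : (1 - q ^ A) * g (A - 1) B = ∑ k ∈ Finset.range n,
        (1 - q ^ A) * hermiteCoeff q (A - 1) B k * g 0 (A + 1 + B - 2 * (k + 1)) := by
      cases A with
      | zero => simp
      | succ A =>
        rw [ih (A + 1 - 1) (by omega) B n (by omega) (by omega), Finset.mul_sum]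
        refine Finset.sum_congr rfl fun k _ => ?_
        rw [mul_assoc, show A + 1 - 1 + B - 2 * k = A + 1 + 1 + B - 2 * (k + 1) by omega]
    have h3 : (1 - q ^ B) * g A (B - 1) = ∑ k ∈ Finset.range n,
        (1 - q ^ B) * hermiteCoeff q A (B - 1) k * g 0 (A + 1 + B - 2 * (k + 1)) := by
      cases B with
      | zero => simp
      | succ B =>
        rw [ih A (by omega) (B + 1 - 1) n (by omega) (by omega), Finset.mul_sum]
        refine Finset.sum_congr rfl fun k _ => ?_
        rw [mul_assoc, show A + (B + 1 - 1) - 2 * k = A + 1 + (B + 1) - 2 * (k + 1) by omega]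
    have h4 := hg A B (by omega)
    rw [h1, h2, h3, Finset.sum_range_succ', hermiteCoeff_zero_right] at h4
    rw [Finset.sum_range_succ', hermiteCoeff_zero_right, show A + 1 + B = A + (B + 1) by ring]
    rw [show A + 1 + B = A + (B + 1) by ring] at h4
    have h5 : ∑ k ∈ Finset.range n,
        hermiteCoeff q (A + 1) B (k + 1) * g 0 (A + (B + 1) - 2 * (k + 1)) =
        ∑ k ∈ Finset.range n, (hermiteCoeff q A (B + 1) (k + 1) * g 0 (A + (B + 1) - 2 * (k + 1)) +
          (1 - q ^ B) * hermiteCoeff q A (B - 1) k * g 0 (A + (B + 1) - 2 * (k + 1)) -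
          (1 - q ^ A) * hermiteCoeff q (A - 1) B k * g 0 (A + (B + 1) - 2 * (k + 1))) := by
      refine Finset.sum_congr rfl fun k _ => ?_
      linear_combination g 0 (A + (B + 1) - 2 * (k + 1)) * hermiteCoeff_relation hq0 hq A B k
    rw [h5, Finset.sum_sub_distrib, Finset.sum_add_distrib]
    linear_combination h4

end linearization

/-! ### Linearization of the chain generating function. -/

section chainTotal

variable {q : K} {ε : ℕ → ℤ}

theorem chainTotal_eq_sum (hq0 : q ≠ 0) (hq : ∀ j : ℕ, 1 ≤ j → q ^ j ≠ 1)
    (hε0 : ∀ i, 0 ≤ ε i) (hε1 : ∀ i, ε i ≤ 1) (hε : ∀ i, ε (i + 1) ≤ ε i) (n : ℕ)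
    {A B c : ℕ} (hc : A + B + 1 ≤ c) :
    chainTotal q ε c n A B = ∑ k ∈ Finset.range (A + 1),
      hermiteCoeff q A B k * chainTotal q ε c n 0 (A + B - 2 * k : ℕ) := by
  have h := eq_sum_hermiteCoeff hq0 hq (S := A + B)
    (g := fun A B => chainTotal q ε c n A B) ?_ A B (A + 1) le_rfl (by omega)
  · simpa using h
  intro A' B' h
  have key := chainTotal_relation (c := c) hq0 hq hε0 hε1 hε n (A := A') (B := B')
    (by omega) (by omega) (by omega) (by omega)
  rw [zpow_natCast, zpow_natCast] at key
  -- Natural and integer predecessors differ only at `0`, where the factor vanishes.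
  have e1 : (1 - q ^ A') * chainTotal q ε c n ((A' - 1 : ℕ) : ℤ) B' =
      (1 - q ^ A') * chainTotal q ε c n ((A' : ℤ) - 1) B' := by
    cases A' with
    | zero => simp
    | succ A' => simp
  have e2 : (1 - q ^ B') * chainTotal q ε c n A' ((B' - 1 : ℕ) : ℤ) =
      (1 - q ^ B') * chainTotal q ε c n A' ((B' : ℤ) - 1) := by
    cases B' with
    | zero => simp
    | succ B' => simp
  rw [e1, e2]
  push_cast
  exact key

end chainTotal

/-! ### Chain sums as sums over tuples. -/

section expansion

/-- The partial sums `μ_j = A + ∑_{i < j} (2 a_i + ε_i)`. -/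
def partialSum (ε : ℕ → ℤ) (A : ℤ) (a : ℕ → ℤ) (j : ℕ) : ℤ :=
  A + ∑ i ∈ Finset.range j, (2 * a i + ε i)

lemma partialSum_zero (ε : ℕ → ℤ) (A : ℤ) (a : ℕ → ℤ) : partialSum ε A a 0 = A := by
  simp [partialSum]

lemma partialSum_succ (ε : ℕ → ℤ) (A : ℤ) (a : ℕ → ℤ) (j : ℕ) :
    partialSum ε A a (j + 1) = partialSum ε A a j + (2 * a j + ε j) := by
  rw [partialSum, Finset.sum_range_succ, ← add_assoc]
  rfl

lemma partialSum_congr (ε : ℕ → ℤ) (A : ℤ) {a b : ℕ → ℤ} {j : ℕ} (h : ∀ i < j, a i = b i) :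
    partialSum ε A a j = partialSum ε A b j := by
  rw [partialSum, partialSum]
  congr 1
  exact Finset.sum_congr rfl fun i hi => by rw [h i (Finset.mem_range.1 hi)]

/-- The weight of a single sequence `a_0, …, a_n`. -/
noncomputable def chainWeight (q : K) (ε : ℕ → ℤ) (A : ℤ) (n : ℕ) (a : ℕ → ℤ) : K :=
  (∏ i ∈ Finset.range (n + 1), q ^ (a i * (a i + ε i))) *
    ∏ i ∈ Finset.range n, gaussInt q (partialSum ε A a (i + 1)) (a (i + 1) - a i)

lemma chainWeight_congr (q : K) (ε : ℕ → ℤ) (A : ℤ) {n : ℕ} {a b : ℕ → ℤ}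
    (h : ∀ i < n + 1, a i = b i) : chainWeight q ε A n a = chainWeight q ε A n b := by
  rw [chainWeight, chainWeight]
  congr 1
  · exact Finset.prod_congr rfl fun i hi => by rw [h i (Finset.mem_range.1 hi)]
  · refine Finset.prod_congr rfl fun i hi => ?_
    have := Finset.mem_range.1 hi
    rw [h i (by omega), h (i + 1) (by omega), partialSum_congr ε A fun k hk => h k (by omega)]

lemma chainWeight_succ (q : K) (ε : ℕ → ℤ) (A : ℤ) (n : ℕ) (a : ℕ → ℤ) :
    chainWeight q ε A (n + 1) a = q ^ (a (n + 1) * (a (n + 1) + ε (n + 1))) *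
      (chainWeight q ε A n a * gaussInt q (partialSum ε A a (n + 1)) (a (n + 1) - a n)) := by
  rw [chainWeight, Finset.prod_range_succ _ (n + 1), chainWeight,
    Finset.prod_range_succ (fun i => gaussInt q (partialSum ε A a (i + 1)) (a (i + 1) - a i)) n]
  ring

/-- A finite tuple with entries in `[-c, c]`, continued by the constant `x`. -/
def extendSeq {c : ℤ} {n : ℕ} (v : Fin n → Finset.Icc (-c) c) (x : ℤ) (i : ℕ) : ℤ :=
  if h : i < n then v ⟨i, h⟩ else x

lemma extendSeq_of_lt {c : ℤ} {n : ℕ} (v : Fin n → Finset.Icc (-c) c) (x : ℤ) {i : ℕ}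
    (h : i < n) : extendSeq v x i = v ⟨i, h⟩ := dif_pos h

lemma extendSeq_self {c : ℤ} {n : ℕ} (v : Fin n → Finset.Icc (-c) c) (x : ℤ) :
    extendSeq v x n = x := dif_neg (lt_irrefl n)

lemma extendSeq_snoc {c : ℤ} {n : ℕ} (v : Fin n → Finset.Icc (-c) c) (y : Finset.Icc (-c) c)
    (x : ℤ) {i : ℕ} (h : i < n + 1) :
    extendSeq (Fin.snoc (α := fun _ => Finset.Icc (-c) c) v y) x i = extendSeq v y i := by
  rw [extendSeq_of_lt _ _ h, extendSeq]
  split_ifs with h'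
  · rw [show (⟨i, h⟩ : Fin (n + 1)) = Fin.castSucc ⟨i, h'⟩ from rfl, Fin.snoc_castSucc]
  · rw [show (⟨i, h⟩ : Fin (n + 1)) = Fin.last n from Fin.ext (by simp; omega), Fin.snoc_last]

lemma sum_snoc {c : ℤ} {n : ℕ} (f : (Fin (n + 1) → Finset.Icc (-c) c) → K) :
    ∑ v, f v = ∑ y : Finset.Icc (-c) c, ∑ v : Fin n → Finset.Icc (-c) c,
      f (Fin.snoc (α := fun _ => Finset.Icc (-c) c) v y) := by
  rw [← Fintype.sum_prod_type']
  exact ((Fin.snocEquiv fun _ => Finset.Icc (-c) c).sum_comp f).symm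

lemma chainSum_eq_sum_weight (q : K) (ε : ℕ → ℤ) (c : ℤ) (n : ℕ) (A B x : ℤ) :
    chainSum q ε c n A B x = ∑ v : Fin n → Finset.Icc (-c) c,
      if partialSum ε A (extendSeq v x) (n + 1) = B then chainWeight q ε A n (extendSeq v x)
      else 0 := by
  induction n generalizing B x with
  | zero =>
    simp only [Finset.univ_unique, Finset.sum_singleton, chainSum, chainWeight, partialSum,
      zero_add, Finset.range_one, Finset.range_zero, Finset.prod_singleton, Finset.prod_empty,
      Finset.sum_singleton, mul_one, extendSeq_self, eq_comm (a := B), add_assoc]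
  | succ n ih =>
    rw [chainSum, sum_snoc, ← Finset.sum_coe_sort, Finset.mul_sum]
    refine Finset.sum_congr rfl fun y _ => ?_
    rw [ih, Finset.sum_mul, Finset.mul_sum]
    refine Finset.sum_congr rfl fun v _ => ?_
    have hs : ∀ i < n + 1, extendSeq (Fin.snoc (α := fun _ => Finset.Icc (-c) c) v y) x i =
      extendSeq v y i := fun i hi => extendSeq_snoc v y x hi
    rw [chainWeight_succ, partialSum_succ ε A _ (n + 1), chainWeight_congr q ε A hs, partialSum_congr ε A hs,
      extendSeq_self, hs n (by omega), extendSeq_self]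
    by_cases h : partialSum ε A (extendSeq v y) (n + 1) = B - 2 * x - ε (n + 1)
    · rw [if_pos h, if_pos (by omega), h]
    · rw [if_neg h, if_neg (by omega), zero_mul, mul_zero]

lemma chainTotal_eq_sum_weight (q : K) (ε : ℕ → ℤ) (c : ℤ) (n : ℕ) (A B : ℤ) :
    chainTotal q ε c n A B = ∑ v : Fin (n + 1) → Finset.Icc (-c) c,
      if partialSum ε A (extendSeq v 0) (n + 1) = B then chainWeight q ε A n (extendSeq v 0)
      else 0 := by
  rw [chainTotal, sum_snoc, ← Finset.sum_coe_sort]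
  refine Finset.sum_congr rfl fun y _ => ?_
  rw [chainSum_eq_sum_weight]
  refine Finset.sum_congr rfl fun v _ => ?_
  have hs : ∀ i < n + 1, extendSeq (Fin.snoc (α := fun _ => Finset.Icc (-c) c) v y) 0 i =
    extendSeq v y i := fun i hi => extendSeq_snoc v y 0 hi
  rw [chainWeight_congr q ε A hs, partialSum_congr ε A hs]

end expansion

/-! ### The inverse Cartan matrix and summation by parts. -/

section cartan

lemma cartan_inv_mulVec_cartan (N : ℕ) (v : Fin (N - 1) → ℚ) :
    (cartan N)⁻¹ *ᵥ (cartan N *ᵥ v) = v := by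
  have hdet : IsUnit (cartan N).det := by
    -- A singular matrix would have inverse `0` by convention, but the first diagonal entry of the
    -- known inverse is `1 - 1 / N`.
    by_contra h
    have h0 := cartan_inv N
    rw [Matrix.nonsing_inv_apply_not_isUnit _ h] at h0
    rcases Nat.eq_zero_or_pos (N - 1) with h1 | h1
    · have : IsEmpty (Fin (N - 1)) := by rw [h1]; infer_instance
      exact h (by rw [Matrix.det_isEmpty]; exact isUnit_one)
    · have h2 := congrFun (congrFun h0 ⟨0, h1⟩) ⟨0, h1⟩
      have hN : (2 : ℚ) ≤ N := by exact_mod_cast (show 2 ≤ N by omega)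
      simp only [Matrix.zero_apply, Matrix.of_apply, zero_add, min_self, Nat.cast_one,
        one_mul] at h2
      field_simp at h2
      linarith
  rw [Matrix.mulVec_mulVec, Matrix.nonsing_inv_mul _ hdet, Matrix.one_mulVec]

lemma cartan_mulVec (N : ℕ) (h : ℕ → ℚ) (h0 : h 0 = 0) (hN : h N = 0) :
    (cartan N *ᵥ fun j => h (j + 1)) = fun j : Fin (N - 1) => 2 * h (j + 1) - h j - h (j + 2) := by
  ext j
  rw [cartan, Matrix.sub_mulVec, Pi.sub_apply, incidence_mulVec N h h0 hN,
    show (2 : Matrix (Fin (N - 1)) (Fin (N - 1)) ℚ) = 1 + 1 by norm_num, Matrix.add_mulVec,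
    Matrix.one_mulVec, Pi.add_apply]
  ring

/-- The right side vanishes at both ends `0` and `N`, so `C` acts on it as minus the second
difference. -/
lemma cartan_inv_mulVec_sub {N : ℕ} (hN : 1 ≤ N) (b : ℕ → ℚ) :
    ((cartan N)⁻¹ *ᵥ fun j : Fin (N - 1) => b (j + 1) - b j) = fun j : Fin (N - 1) =>
      ((j + 1 : ℕ) : ℚ) * ((∑ i ∈ Finset.range N, b i) / N) -
        ∑ i ∈ Finset.range (j + 1), b i := by
  have hN' : (N : ℚ) ≠ 0 := by norm_cast; omega
  have h := cartan_mulVec N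
    (fun j => (j : ℚ) * ((∑ i ∈ Finset.range N, b i) / N) - ∑ i ∈ Finset.range j, b i)
    (by simp) (by field_simp; simp)
  rw [← cartan_inv_mulVec_cartan N fun j : Fin (N - 1) => ((j + 1 : ℕ) : ℚ) * _ - _, h]
  congr 1
  ext j
  simp only [Finset.sum_range_succ, Nat.cast_add, Nat.cast_one, Nat.cast_ofNat]
  ring

lemma sum_sub_mul_eq (b h : ℕ → ℚ) (h0 : h 0 = 0) (n : ℕ) :
    ∑ j ∈ Finset.range n, (b (j + 1) - b j) * h (j + 1) =
      b n * h (n + 1) - ∑ i ∈ Finset.range (n + 1), b i * (h (i + 1) - h i) := by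
  induction n with
  | zero => simp [h0]
  | succ n ih =>
    rw [Finset.sum_range_succ, ih, Finset.sum_range_succ _ (n + 1)]
    ring

lemma dotProduct_cartan_inv {N : ℕ} (hN : 1 ≤ N) (a e : ℕ → ℚ) :
    (fun j : Fin (N - 1) => a (j + 1) - a j) ⬝ᵥ
        ((cartan N)⁻¹ *ᵥ fun j : Fin (N - 1) => (a (j + 1) + e (j + 1)) - (a j + e j)) =
      ∑ i ∈ Finset.range N, a i * (a i + e i) -
        (∑ i ∈ Finset.range N, a i) * (∑ i ∈ Finset.range N, (a i + e i)) / N := by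
  have hN' : (N : ℚ) ≠ 0 := by norm_cast; omega
  obtain ⟨S, hS⟩ : ∃ S, S = ∑ i ∈ Finset.range N, (a i + e i) := ⟨_, rfl⟩
  have h := sum_sub_mul_eq a
    (fun j => (j : ℚ) * (S / N) - ∑ i ∈ Finset.range j, (a i + e i)) (by simp) (N - 1)
  rw [cartan_inv_mulVec_sub hN (fun j => a j + e j), dotProduct, ← hS]
  rw [Fin.sum_univ_eq_sum_range (fun j => (a (j + 1) - a j) * (((j + 1 : ℕ) : ℚ) *
    (S / N) - ∑ i ∈ Finset.range (j + 1), (a i + e i))) (N - 1), h, Nat.sub_add_cancel hN, ← hS,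
    mul_div_cancel₀ _ hN', sub_self, mul_zero, zero_sub, Finset.sum_mul, Finset.sum_div,
    ← Finset.sum_sub_distrib, ← Finset.sum_neg_distrib]
  refine Finset.sum_congr rfl fun i _ => ?_
  rw [Finset.sum_range_succ]
  push_cast
  ring

lemma unitVec_one_dotProduct {N : ℕ} (hN : 1 ≤ N) (h : ℕ → ℚ) (hhN : h N = 0) :
    unitVec N 1 ⬝ᵥ (fun j : Fin (N - 1) => h (j + 1)) = h 1 := by
  rw [dotProduct]
  rcases hN.eq_or_lt with rfl | hN
  · rw [hhN]
    exact Finset.sum_eq_zero fun j _ => absurd j.2 (by omega)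
  · rw [Finset.sum_eq_single (⟨0, by omega⟩ : Fin (N - 1))]
    · simp [unitVec]
    · intro j _ hj
      have : (j : ℕ) ≠ 0 := fun h => hj (Fin.ext h)
      simp [unitVec, this]
    · simp

lemma unitVec_one_dotProduct_cartan_inv {N : ℕ} (hN : 1 ≤ N) (a : ℕ → ℚ) :
    unitVec N 1 ⬝ᵥ ((cartan N)⁻¹ *ᵥ fun j : Fin (N - 1) => a (j + 1) - a j) =
      (∑ i ∈ Finset.range N, a i) / N - a 0 := by
  have hN' : (N : ℚ) ≠ 0 := by norm_cast; omega
  rw [cartan_inv_mulVec_sub hN, unitVec_one_dotProduct hN fun j =>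
    (j : ℚ) * ((∑ i ∈ Finset.range N, a i) / N) - ∑ i ∈ Finset.range j, a i]
  · simp
  · field_simp
    simp

/-- The system with source `A e_1 + B e_{N-1} + e_ℓ`, written with the boundary values
`μ_0 = A`, `μ_N = B`. -/
lemma isSystem_iff {N : ℕ} (hN : 1 ≤ N) (ℓ : ℕ) (u : ℕ → ℚ) {m n : Fin (N - 1) → ℕ}
    (hm : ∀ j : Fin (N - 1), (m j : ℚ) = u (j + 1)) :
    IsSystem N (u 0 • unitVec N 1 + u N • unitVec N (N - 1) + unitVec N ℓ) m n ↔
      ∀ j : Fin (N - 1), 2 * (u (j + 1) + n j) =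
        u j + u (j + 2) + if (j : ℕ) + 1 = ℓ then 1 else 0 := by
  -- `incidence_mulVec` needs zero boundary values; the source terms restore `u 0` and `u N`.
  set g : ℕ → ℚ := fun k => if k = 0 ∨ k = N then 0 else u k with hg
  have e1 : toRat m = fun j : Fin (N - 1) => g (j + 1) := by
    ext j
    have := j.2
    rw [hg, toRat, hm]
    simp only
    rw [if_neg (by omega)]
  rw [IsSystem, funext_iff]
  refine forall_congr' fun j => ?_
  have hj := j.2
  have e2 : g j + u 0 * (if (j : ℕ) + 1 = 1 then 1 else 0) = u j := by
    simp only [hg]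
    rcases Nat.eq_zero_or_pos (j : ℕ) with h | h
    · simp [h]
    · rw [if_neg (by omega), if_neg (by omega)]
      ring
  have e3 : g (j + 2) + u N * (if (j : ℕ) + 1 = N - 1 then 1 else 0) = u (j + 2) := by
    simp only [hg]
    by_cases h : (j : ℕ) + 2 = N
    · simp [h, show (j : ℕ) + 1 = N - 1 by omega]
    · rw [if_neg (by omega), if_neg (by omega)]
      ring
  have e4 : (incidence N *ᵥ toRat m) j = g j + g (j + 2) := by
    rw [e1]
    exact incidence_mulVec N g (by simp [hg]) (by simp [hg]) j
  simp only [Pi.add_apply, Pi.smul_apply, smul_eq_mul, e4]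
  rw [← e2, ← e3, ← hm j]
  simp only [toRat, unitVec]
  constructor <;> intro h <;> linarith

end cartan

/-- The sequence with `ℓ` ones followed by zeros. -/
def stepSeq (ℓ i : ℕ) : ℤ := if i < ℓ then 1 else 0

lemma stepSeq_nonneg (ℓ i : ℕ) : 0 ≤ stepSeq ℓ i := by
  rw [stepSeq]; split_ifs <;> omega

lemma stepSeq_le_one (ℓ i : ℕ) : stepSeq ℓ i ≤ 1 := by
  rw [stepSeq]; split_ifs <;> omega

/-- Thus `e_ℓ` is the decrement of `ε`, so `n - e_ℓ` is the increment of `a + ε`. -/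
lemma stepSeq_sub (ℓ j : ℕ) :
    stepSeq ℓ j - stepSeq ℓ (j + 1) = if j + 1 = ℓ then 1 else 0 := by
  rw [stepSeq, stepSeq]; split_ifs <;> omega

lemma stepSeq_succ_le (ℓ i : ℕ) : stepSeq ℓ (i + 1) ≤ stepSeq ℓ i := by
  have := stepSeq_sub ℓ i
  split_ifs at this <;> omega

lemma sum_stepSeq {N ℓ : ℕ} (hℓ : ℓ ≤ N) : ∑ i ∈ Finset.range N, stepSeq ℓ i = ℓ := by
  simp only [stepSeq]
  rw [← Finset.sum_filter, Finset.sum_const, nsmul_eq_mul, mul_one]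
  congr 1
  rw [show (Finset.range N).filter (· < ℓ) = Finset.range ℓ by ext; simp; omega, Finset.card_range]

lemma partialSum_stepSeq {N ℓ : ℕ} (hℓ : ℓ ≤ N) (A : ℤ) (a : ℕ → ℤ) :
    partialSum (stepSeq ℓ) A a N = A + 2 * ∑ i ∈ Finset.range N, a i + ℓ := by
  rw [partialSum, Finset.sum_add_distrib, sum_stepSeq hℓ, ← Finset.mul_sum, add_assoc]

lemma zpow_sum_range {q : K} (hq0 : q ≠ 0) (f : ℕ → ℤ) (n : ℕ) :
    q ^ (∑ i ∈ Finset.range n, f i) = ∏ i ∈ Finset.range n, q ^ f i := by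
  induction n with
  | zero => simp
  | succ n ih => rw [Finset.sum_range_succ, Finset.prod_range_succ, zpow_add₀ hq0, ih]

/-- The common form `A e_1 + (A + 2 L + ℓ) e_{N-1} + e_ℓ` of the sources of both systems. -/
def sourceVec (N ℓ A L : ℕ) : Fin (N - 1) → ℚ :=
  (A : ℚ) • unitVec N 1 + ((A : ℚ) + 2 * L + ℓ) • unitVec N (N - 1) + unitVec N ℓ

lemma sourceDelta_eq (N ℓ L : ℕ) : sourceDelta N ℓ L = sourceVec N ℓ 0 L := by
  simp [sourceDelta, sourceVec]

lemma sourceGamma_eq {M L : ℕ} (N ℓ : ℕ) (h : L ≤ M) :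
    sourceGamma M N ℓ L = sourceVec N ℓ (M - L) L := by
  rw [sourceGamma, sourceVec, Nat.cast_sub h, show (M : ℚ) - L + 2 * L + ℓ = M + L + ℓ by ring]

/-- The pair `(m, n)` consists of the interior partial sums and the increments of the
sequence `a`. -/
def IsChainPair (N ℓ A L : ℕ) (a : ℕ → ℤ) (p : (Fin (N - 1) → ℕ) × (Fin (N - 1) → ℕ)) : Prop :=
  (∀ j : Fin (N - 1), (p.1 j : ℤ) = partialSum (stepSeq ℓ) A a (j + 1)) ∧
  (∀ j : Fin (N - 1), (p.2 j : ℤ) = a (j + 1) - a j) ∧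
  partialSum (stepSeq ℓ) A a N = A + 2 * L + ℓ

/-! ### Solutions of the systems as integer chains. -/

section pair

variable {N ℓ A L : ℕ} {a : ℕ → ℤ} {p : (Fin (N - 1) → ℕ) × (Fin (N - 1) → ℕ)}

lemma IsChainPair.sum_eq (hℓ : ℓ ≤ N) (h : IsChainPair N ℓ A L a p) :
    ∑ i ∈ Finset.range N, a i = L := by
  have := h.2.2
  rw [partialSum_stepSeq hℓ] at this
  omega

lemma IsChainPair.toRat_snd (h : IsChainPair N ℓ A L a p) :
    toRat p.2 = fun j : Fin (N - 1) => (a (j + 1) : ℚ) - a j := by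
  ext j
  have := h.2.1 j
  rw [toRat]
  exact_mod_cast this

lemma IsChainPair.toRat_snd_sub (h : IsChainPair N ℓ A L a p) :
    toRat p.2 - unitVec N ℓ = fun j : Fin (N - 1) =>
      ((a (j + 1) : ℚ) + (stepSeq ℓ (j + 1) : ℤ)) - ((a j : ℚ) + (stepSeq ℓ j : ℤ)) := by
  ext j
  have h1 : ((stepSeq ℓ j - stepSeq ℓ (j + 1) : ℤ) : ℚ) = unitVec N ℓ j := by
    rw [stepSeq_sub, unitVec]
    split_ifs <;> simp
  rw [Pi.sub_apply, h.toRat_snd, ← h1]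
  push_cast
  ring

lemma IsChainPair.mem_fermionicIndex (hN : 1 ≤ N) (hℓ : ℓ ≤ N) (h : IsChainPair N ℓ A L a p) :
    p ∈ fermionicIndex N L (sourceVec N ℓ A L) := by
  refine ⟨?_, a 0, ?_⟩
  · have key := (isSystem_iff hN ℓ (fun j => (partialSum (stepSeq ℓ) A a j : ℚ))
      (m := p.1) (n := p.2) fun j => by exact_mod_cast h.1 j).2 fun j => ?_
    · simp only [h.2.2, partialSum_zero] at key
      rw [sourceVec]
      exact_mod_cast key
    · have h1 : 2 * (partialSum (stepSeq ℓ) A a (j + 1) + (p.2 j : ℤ)) =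
          partialSum (stepSeq ℓ) A a j + partialSum (stepSeq ℓ) A a (j + 2) +
            if (j : ℕ) + 1 = ℓ then 1 else 0 := by
        rw [h.2.1, ← stepSeq_sub, partialSum_succ _ _ _ (j + 1), partialSum_succ _ _ _ j]
        ring
      have h2 := congrArg (Int.cast : ℤ → ℚ) h1
      push_cast at h2
      exact h2
  · rw [h.toRat_snd, unitVec_one_dotProduct_cartan_inv hN fun i => (a i : ℚ), ← Int.cast_sum,
      h.sum_eq hℓ]
    push_cast
    ring

lemma IsChainPair.weight_eq {q t : K} (ht : t ^ N = q) (ht0 : t ≠ 0)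
    (hN : 1 ≤ N) (hℓ : ℓ ≤ N) (h : IsChainPair N ℓ A L a p) :
    qPow t N ((L : ℚ) * (L + ℓ) / N) *
        (qPow t N (toRat p.2 ⬝ᵥ ((cartan N)⁻¹ *ᵥ (toRat p.2 - unitVec N ℓ))) *
          ∏ j, qBinom q (p.1 j + p.2 j) (p.2 j)) =
      chainWeight q (stepSeq ℓ) A (N - 1) a := by
  have hN' : (N : ℚ) ≠ 0 := by norm_cast; omega
  have hq0 : q ≠ 0 := ht ▸ pow_ne_zero _ ht0
  obtain ⟨E, hE⟩ : ∃ E, E = ∑ i ∈ Finset.range N, a i * (a i + stepSeq ℓ i) := ⟨_, rfl⟩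
  have hsum : ∑ i ∈ Finset.range N, ((a i : ℚ) + (stepSeq ℓ i : ℤ)) = L + ℓ := by
    have := h.sum_eq hℓ
    have h1 : ∑ i ∈ Finset.range N, (a i + stepSeq ℓ i) = L + ℓ := by
      rw [Finset.sum_add_distrib, this, sum_stepSeq hℓ]
    exact_mod_cast h1
  have hexp : toRat p.2 ⬝ᵥ ((cartan N)⁻¹ *ᵥ (toRat p.2 - unitVec N ℓ)) =
      E - (L : ℚ) * (L + ℓ) / N := by
    rw [h.toRat_snd_sub, h.toRat_snd,
      dotProduct_cartan_inv hN (fun i => (a i : ℚ)) (fun i => ((stepSeq ℓ i : ℤ) : ℚ)), hsum,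
      ← Int.cast_sum, h.sum_eq hℓ, hE]
    push_cast
    rfl
  have e1 : (N : ℚ) * ((L : ℚ) * (L + ℓ) / N) = ((L * (L + ℓ) : ℤ) : ℚ) := by
    push_cast
    field_simp
  have e2 : (N : ℚ) * (E - (L : ℚ) * (L + ℓ) / N) = ((N * E - L * (L + ℓ) : ℤ) : ℚ) := by
    push_cast
    field_simp
  rw [hexp, qPow, qPow, e1, e2, Int.floor_intCast, Int.floor_intCast, ← mul_assoc,
    ← zpow_add₀ ht0, add_sub_cancel, zpow_mul, zpow_natCast, ht, hE, zpow_sum_range hq0,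
    chainWeight, Nat.sub_add_cancel hN]
  congr 1
  rw [← Fin.prod_univ_eq_prod_range (fun i =>
    gaussInt q (partialSum (stepSeq ℓ) A a (i + 1)) (a (i + 1) - a i))]
  refine Finset.prod_congr rfl fun j _ => ?_
  rw [← h.1, ← h.2.1, gaussInt_natCast]

/-- The system determines a rational sequence `b` from the partial sums, with increments `n`. The
congruence makes `b 0` an integer, hence every entry. -/
lemma exists_isChainPair (hN : 1 ≤ N) (hℓ : ℓ ≤ N)
    (hp : p ∈ fermionicIndex N L (sourceVec N ℓ A L)) : ∃ a, IsChainPair N ℓ A L a p := by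
  obtain ⟨hsys, z, hz⟩ := hp
  obtain ⟨m, n⟩ := p
  simp only at hsys hz
  set u : ℕ → ℚ := fun k => if k = 0 then (A : ℚ) else
    if h : k - 1 < N - 1 then (m ⟨k - 1, h⟩ : ℚ) else A + 2 * L + ℓ with hu
  have hu0 : u 0 = A := if_pos rfl
  have huN : u N = A + 2 * L + ℓ := by
    simp only [hu]
    rw [if_neg (by omega), dif_neg (by omega)]
  have hum : ∀ j : Fin (N - 1), (m j : ℚ) = u (j + 1) := by
    intro j
    simp only [hu]
    rw [if_neg (by omega), dif_pos (show (j : ℕ) + 1 - 1 < N - 1 from j.2)]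
    rfl
  rw [sourceVec, ← huN, ← hu0, isSystem_iff hN ℓ u hum] at hsys
  obtain ⟨b, hb⟩ : ∃ b : ℕ → ℚ, ∀ i, 2 * b i + (stepSeq ℓ i : ℤ) = u (i + 1) - u i :=
    ⟨fun i => (u (i + 1) - u i - (stepSeq ℓ i : ℤ)) / 2, fun i => by ring⟩
  have hn : ∀ j : Fin (N - 1), (n j : ℚ) = b (j + 1) - b j := by
    intro j
    have h1 := hsys j
    have h2 : ((stepSeq ℓ j - stepSeq ℓ (j + 1) : ℤ) : ℚ) =
        if (j : ℕ) + 1 = ℓ then 1 else 0 := by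
      rw [stepSeq_sub]
      split_ifs <;> simp
    rw [← h2] at h1
    push_cast at h1
    linarith [hb j, hb (j + 1)]
  have hbsum : ∀ k, u k = A + ∑ i ∈ Finset.range k, (2 * b i + (stepSeq ℓ i : ℤ)) := by
    intro k
    simp only [hb]
    rw [Finset.sum_range_sub, hu0]
    ring
  have hbL : ∑ i ∈ Finset.range N, b i = L := by
    have h1 := hbsum N
    have h2 : ∑ i ∈ Finset.range N, ((stepSeq ℓ i : ℤ) : ℚ) = ℓ := by
      exact_mod_cast sum_stepSeq hℓ
    rw [huN, Finset.sum_add_distrib, h2, ← Finset.mul_sum] at h1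
    linarith
  have hb0 : b 0 = z := by
    rw [show toRat n = fun j : Fin (N - 1) => b (j + 1) - b j from funext hn,
      unitVec_one_dotProduct_cartan_inv hN b, hbL] at hz
    linarith
  set a : ℕ → ℤ := fun i => z + ∑ k ∈ Finset.range i, if h : k < N - 1 then (n ⟨k, h⟩ : ℤ) else 0
    with ha
  have hab : ∀ i < N, (a i : ℚ) = b i := by
    intro i hi
    induction i with
    | zero => simp [ha, hb0]
    | succ i ih =>
      have h1 : a (i + 1) = a i + n ⟨i, by omega⟩ := by
        simp only [ha]
        rw [Finset.sum_range_succ, dif_pos (show i < N - 1 by omega)]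
        ring
      have h2 := hn ⟨i, by omega⟩
      simp only at h2
      rw [h1]
      push_cast
      rw [ih (by omega), h2]
      ring
  have hau : ∀ k ≤ N, (partialSum (stepSeq ℓ) A a k : ℚ) = u k := by
    intro k hk
    rw [hbsum, partialSum]
    push_cast
    congr 1
    refine Finset.sum_congr rfl fun i hi => ?_
    rw [hab i (by have := Finset.mem_range.1 hi; omega)]
  refine ⟨a, fun j => ?_, fun j => ?_, ?_⟩
  · have h1 := hau (j + 1) (by omega)
    rw [← hum] at h1
    exact_mod_cast h1.symm
  · have h1 := hn j
    rw [← hab _ (by omega), ← hab _ (by omega)] at h1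
    exact_mod_cast h1
  · have h1 := hau N le_rfl
    rw [huN] at h1
    exact_mod_cast h1

lemma IsChainPair.monotone (h : IsChainPair N ℓ A L a p) {i j : ℕ} (hij : i ≤ j) (hj : j < N) :
    a i ≤ a j := by
  induction j, hij using Nat.le_induction with
  | base => exact le_rfl
  | succ j _ ih =>
    have h1 := h.2.1 ⟨j, by omega⟩
    simp only at h1
    have h2 := ih (by omega)
    omega

lemma IsChainPair.partialSum_nonneg (h : IsChainPair N ℓ A L a p) {k : ℕ} (hk : k ≤ N) :
    0 ≤ partialSum (stepSeq ℓ) A a k := by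
  rcases Nat.eq_zero_or_pos k with rfl | h0
  · rw [partialSum_zero]
    omega
  rcases hk.eq_or_lt with rfl | h1
  · rw [h.2.2]
    omega
  · obtain ⟨k, rfl⟩ : ∃ m, k = m + 1 := ⟨k - 1, by omega⟩
    rw [← h.1 ⟨k, by omega⟩]
    omega

/-- Non-negativity of the partial sums of index `1` and `N - 1` bounds the smallest entry below and
the largest above. -/
lemma IsChainPair.mem_Icc {c : ℤ} (hN : 1 ≤ N) (hc : (A : ℤ) + 2 * L + ℓ + 1 ≤ c)
    (h : IsChainPair N ℓ A L a p) {i : ℕ} (hi : i < N) : a i ∈ Finset.Icc (-c) c := by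
  have h1 := h.monotone (Nat.zero_le i) hi
  have h2 := h.monotone (show i ≤ N - 1 by omega) (by omega)
  have h3 := h.partialSum_nonneg hN
  have h4 := h.partialSum_nonneg (show N - 1 ≤ N by omega)
  have h5 := h.2.2
  have h6 := partialSum_succ (stepSeq ℓ) A a (N - 1)
  rw [← zero_add 1, partialSum_succ, partialSum_zero] at h3
  rw [Nat.sub_add_cancel hN] at h6
  have h7 := stepSeq_le_one ℓ 0
  have h8 := stepSeq_nonneg ℓ (N - 1)
  rw [Finset.mem_Icc]
  omega

end pair

/-- The interior partial sums and the increments of `a`, truncated to natural numbers. -/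
def chainPair (N ℓ A : ℕ) (a : ℕ → ℤ) : (Fin (N - 1) → ℕ) × (Fin (N - 1) → ℕ) :=
  (fun j => (partialSum (stepSeq ℓ) A a (j + 1)).toNat, fun j => (a (j + 1) - a j).toNat)

lemma IsChainPair.eq_chainPair {N ℓ A L : ℕ} {a : ℕ → ℤ}
    {p : (Fin (N - 1) → ℕ) × (Fin (N - 1) → ℕ)} (h : IsChainPair N ℓ A L a p) :
    p = chainPair N ℓ A a := by
  refine Prod.ext (funext fun j => ?_) (funext fun j => ?_)
  · exact (by rw [← h.1, Int.toNat_natCast] :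
      p.1 j = (partialSum (stepSeq ℓ) A a (j + 1)).toNat)
  · exact (by rw [← h.2.1, Int.toNat_natCast] : p.2 j = (a (j + 1) - a j).toNat)

lemma IsChainPair.congr {N ℓ A L : ℕ} {a b : ℕ → ℤ}
    {p : (Fin (N - 1) → ℕ) × (Fin (N - 1) → ℕ)} (h : IsChainPair N ℓ A L a p)
    (hab : ∀ i < N, b i = a i) : IsChainPair N ℓ A L b p := by
  refine ⟨fun j => ?_, fun j => ?_, ?_⟩
  · rw [h.1, partialSum_congr _ _ fun i hi => hab i (by omega)]
  · rw [h.2.1, hab _ (by omega), hab _ (by omega)]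
  · rw [← h.2.2, partialSum_congr _ _ hab]

lemma IsChainPair.injective {N ℓ A L : ℕ} {a b : ℕ → ℤ}
    {p : (Fin (N - 1) → ℕ) × (Fin (N - 1) → ℕ)} (ha : IsChainPair N ℓ A L a p)
    (hb : IsChainPair N ℓ A L b p) {i : ℕ} (hi : i < N) : a i = b i := by
  have key : ∀ k ≤ N, partialSum (stepSeq ℓ) A a k = partialSum (stepSeq ℓ) A b k := by
    intro k hk
    rcases Nat.eq_zero_or_pos k with rfl | h0
    · rw [partialSum_zero, partialSum_zero]
    rcases hk.eq_or_lt with rfl | h1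
    · rw [ha.2.2, hb.2.2]
    · obtain ⟨k, rfl⟩ : ∃ m, k = m + 1 := ⟨k - 1, by omega⟩
      rw [← ha.1 ⟨k, by omega⟩, ← hb.1 ⟨k, by omega⟩]
  have h1 := key i hi.le
  have h2 := key (i + 1) hi
  rw [partialSum_succ, partialSum_succ] at h2
  omega

lemma isChainPair_of_chainWeight_ne_zero {q : K} {N ℓ A L : ℕ} {a : ℕ → ℤ}
    (hB : partialSum (stepSeq ℓ) A a N = A + 2 * L + ℓ)
    (h : chainWeight q (stepSeq ℓ) A (N - 1) a ≠ 0) :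
    IsChainPair N ℓ A L a (chainPair N ℓ A a) := by
  have h1 := Finset.prod_ne_zero_iff.1 (right_ne_zero_of_mul h)
  have h2 : ∀ j : Fin (N - 1), 0 ≤ partialSum (stepSeq ℓ) A a (j + 1) ∧
      0 ≤ a (j + 1) - a j := by
    intro j
    by_contra hc
    exact h1 j (Finset.mem_range.2 j.2) (if_neg hc)
  exact ⟨fun j => Int.toNat_of_nonneg (h2 j).1, fun j => Int.toNat_of_nonneg (h2 j).2, hB⟩

theorem qPow_mul_fermionicSum {q t : K} {N ℓ : ℕ} (ht : t ^ N = q)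
    (ht0 : t ≠ 0) (hN : 1 ≤ N) (hℓ : ℓ ≤ N) (A L : ℕ) {c : ℤ}
    (hc : (A : ℤ) + 2 * L + ℓ + 1 ≤ c) :
    qPow t N ((L : ℚ) * (L + ℓ) / N) * fermionicSum q t N ℓ L (sourceVec N ℓ A L) =
      chainTotal q (stepSeq ℓ) c (N - 1) A (A + 2 * L + ℓ) := by
  classical
  rw [fermionicSum, finsum_mem_eq_finite_toFinset_sum _ (fermionicIndex_finite N L _),
    Finset.mul_sum, chainTotal_eq_sum_weight]
  choose! f hf using fun p (hp : p ∈ fermionicIndex N L (sourceVec N ℓ A L)) =>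
    exists_isChainPair hN hℓ hp
  have hN1 : ∀ a, partialSum (stepSeq ℓ) A a (N - 1 + 1) = partialSum (stepSeq ℓ) A a N :=
    fun a => by rw [Nat.sub_add_cancel hN]
  set g : (Fin (N - 1) → ℕ) × (Fin (N - 1) → ℕ) → Fin (N - 1 + 1) → Finset.Icc (-c) c :=
    fun p i => if h : f p i ∈ Finset.Icc (-c) c then ⟨f p i, h⟩ else
      ⟨0, Finset.mem_Icc.2 ⟨by omega, by omega⟩⟩ with hg
  have hgf : ∀ p ∈ fermionicIndex N L (sourceVec N ℓ A L),
      IsChainPair N ℓ A L (extendSeq (g p) 0) p := by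
    intro p hp
    refine (hf p hp).congr fun i hi => ?_
    rw [extendSeq_of_lt _ _ (show i < N - 1 + 1 by omega)]
    simp only [hg]
    rw [dif_pos ((hf p hp).mem_Icc hN hc hi)]
  -- Only nonzero terms are matched: tuples that are not chains have a vanishing Gaussian factor or
  -- a wrong final partial sum.
  refine Finset.sum_bij_ne_zero (fun p _ _ => g p) (fun _ _ _ => Finset.mem_univ _) ?_ ?_ ?_
  · intro p hp _ p' hp' _ h
    rw [Set.Finite.mem_toFinset] at hp hp'
    rw [(hgf p hp).eq_chainPair, (hgf p' hp').eq_chainPair, h]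
  · intro v _ hv
    rw [hN1] at hv
    have hB : partialSum (stepSeq ℓ) A (extendSeq v 0) N = A + 2 * L + ℓ := by
      by_contra hB
      exact hv (if_neg hB)
    rw [if_pos hB] at hv
    have hpair := isChainPair_of_chainWeight_ne_zero hB hv
    have hmem := hpair.mem_fermionicIndex hN hℓ
    refine ⟨_, (Set.Finite.mem_toFinset _).2 hmem, ?_, ?_⟩
    · rwa [hpair.weight_eq ht ht0 hN hℓ]
    · funext i
      have h1 := (hgf _ hmem).injective hpair (show (i : ℕ) < N by omega)
      rw [extendSeq_of_lt _ _ i.2, extendSeq_of_lt _ _ i.2] at h1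
      exact Subtype.ext h1
  · intro p hp _
    rw [Set.Finite.mem_toFinset] at hp
    rw [(hgf p hp).weight_eq ht ht0 hN hℓ, hN1, if_pos (hgf p hp).2.2]

/-! ### The Bailey transform and the case `N = 1`. -/

section transform

variable {q t : K} {M N ℓ L : ℕ}

/-- The cutoff `2 M + ℓ + 1` does not depend on `L` and also serves `γ`: linearization needs `A + B
+ 1 ≤ c`, and there `A + B = 2 M + ℓ`. -/
lemma deltaSeq_eq (ht : t ^ N = q) (ht0 : t ≠ 0) (hN : 1 ≤ N) (hℓ : ℓ ≤ N) (hL : L ≤ M) :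
    deltaSeq q t M N ℓ L =
      chainTotal q (stepSeq ℓ) (2 * M + ℓ + 1 : ℕ) (N - 1) 0 (2 * L + ℓ : ℕ) /
        qPoch q q (M - L) := by
  have h := qPow_mul_fermionicSum ht ht0 hN hℓ 0 L (c := (2 * M + ℓ + 1 : ℕ))
    (by push_cast; omega)
  rw [deltaSeq, if_pos hL, sourceDelta_eq, div_mul_eq_mul_div, h]
  push_cast
  rw [zero_add]

lemma gammaSeq_eq (ht : t ^ N = q) (ht0 : t ≠ 0) (hN : 1 ≤ N) (hℓ : ℓ ≤ N) (hL : L ≤ M) :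
    gammaSeq q t M N ℓ L =
      chainTotal q (stepSeq ℓ) (2 * M + ℓ + 1 : ℕ) (N - 1) (M - L : ℕ) (M + L + ℓ : ℕ) /
        (qPoch q q (M - L) * qPoch q (q ^ (ℓ + 1)) (M + L)) := by
  have h := qPow_mul_fermionicSum ht ht0 hN hℓ (M - L) L (c := (2 * M + ℓ + 1 : ℕ))
    (by push_cast; omega)
  rw [gammaSeq, if_pos hL, sourceGamma_eq N ℓ hL, div_mul_eq_mul_div, h]
  congr 3
  push_cast [Nat.cast_sub hL]
  ring

/-- Since `(q)_{ℓ+r} = (q)_ℓ (q^(ℓ+1))_r`, the factor `(q)_ℓ` cancels. -/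
lemma hermiteCoeff_div (hq0 : q ≠ 0) (hq : ∀ j : ℕ, 1 ≤ j → q ^ j ≠ 1) (ℓ : ℕ) {M L k : ℕ}
    (hL : L ≤ k) (hk : k ≤ M) :
    hermiteCoeff q (M - L) (M + L + ℓ) (M - k) /
        (qPoch q q (M - L) * qPoch q (q ^ (ℓ + 1)) (M + L)) =
      1 / (qPoch q q (M - k) * (qPoch q q (k - L) * qPoch q (q ^ (ℓ + 1)) (k + L))) := by
  have h0 := qPoch_self_ne_zero hq
  have e1 := qDescPoch_add_mul hq0 (k - L) (M - k)
  have e2 := qDescPoch_add_mul hq0 (ℓ + (k + L)) (M - k)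
  rw [show k - L + (M - k) = M - L by omega] at e1
  rw [show ℓ + (k + L) + (M - k) = M + L + ℓ by omega] at e2
  have e3 := qPoch_add q q ℓ (M + L)
  have e4 := qPoch_add q q ℓ (k + L)
  rw [show ℓ + (M + L) = M + L + ℓ by ring, ← pow_succ'] at e3
  rw [← pow_succ'] at e4
  have n1 := h0 (M - L)
  have n2 := h0 (M + L + ℓ)
  have n3 := h0 (ℓ + (k + L))
  rw [e3] at n2
  rw [e4] at n3
  have n2' := right_ne_zero_of_mul n2
  have n3' := right_ne_zero_of_mul n3
  have n4 := h0 (M - k)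
  have n5 := h0 (k - L)
  rw [e3, e4] at e2
  have e5 : qDescPoch q (M + L + ℓ) (M - k) * qPoch q (q ^ (ℓ + 1)) (k + L) =
      qPoch q (q ^ (ℓ + 1)) (M + L) :=
    mul_left_cancel₀ (h0 ℓ) (by linear_combination e2)
  rw [hermiteCoeff, div_div, div_eq_div_iff 
    (mul_ne_zero n4 (mul_ne_zero n1 n2')) (mul_ne_zero n4 (mul_ne_zero n5 n3'))]
  rw [← e1, ← e5]
  ring

theorem isBaileyTransform_deltaSeq_gammaSeq [TopologicalSpace K] (ht : t ^ N = q) (hN : 1 ≤ N)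
    (hℓ : ℓ ≤ N) (hq0 : q ≠ 0) (hq : ∀ j : ℕ, 1 ≤ j → q ^ j ≠ 1) :
    IsBaileyTransform q (q ^ ℓ) (deltaSeq q t M N ℓ) (gammaSeq q t M N ℓ) := by
  have ht0 : t ≠ 0 := by
    rintro rfl
    exact hq0 (by rw [← ht, zero_pow (by omega)])
  intro L
  set f : ℕ → K := fun k => deltaSeq q t M N ℓ k /
    (qPoch q q (k - L) * qPoch q (q ^ ℓ * q) (k + L)) with hf
  have hf0 : ∀ k, M < k → f k = 0 := fun k hk => by
    simp only [hf]
    rw [deltaSeq, if_neg (by omega), zero_div]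
  suffices h : ∑ k ∈ Finset.Icc L M, f k = gammaSeq q t M N ℓ L by
    refine (hasSum_subtype_iff_indicator (f := f) (s := Set.Ici L)).2 ?_
    rw [← h, Finset.sum_congr rfl fun k hk =>
      (Set.indicator_of_mem (Set.mem_Ici.2 (Finset.mem_Icc.1 hk).1) f).symm]
    refine hasSum_sum_of_ne_finset_zero fun k hk => ?_
    by_cases h1 : k ∈ Set.Ici L
    · rw [Set.indicator_of_mem h1]
      refine hf0 k (not_le.1 fun h2 => hk (Finset.mem_Icc.2 ⟨h1, h2⟩))
    · exact Set.indicator_of_notMem h1 f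
  rcases lt_or_ge M L with hL | hL
  · rw [Finset.Icc_eq_empty_of_lt hL, Finset.sum_empty, gammaSeq, if_neg (by omega)]
  · rw [gammaSeq_eq ht ht0 hN hℓ hL, chainTotal_eq_sum hq0 hq (stepSeq_nonneg ℓ)
      (stepSeq_le_one ℓ) (stepSeq_succ_le ℓ) (N - 1) (by omega), Finset.sum_div]
    -- The linearization index is `M - k`, so that `A + B - 2 (M - k) = 2 k + ℓ`.
    refine Finset.sum_nbij' (fun k => M - k) (fun k => M - k) ?_ ?_ ?_ ?_ ?_
    · intro k hk
      simp only [Finset.mem_Icc, Finset.mem_range] at hk ⊢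
      omega
    · intro k hk
      simp only [Finset.mem_Icc, Finset.mem_range] at hk ⊢
      omega
    · intro k hk
      simp only [Finset.mem_Icc] at hk
      omega
    · intro k hk
      simp only [Finset.mem_range] at hk
      omega
    · intro k hk
      obtain ⟨h1, h2⟩ := Finset.mem_Icc.1 hk
      simp only [hf]
      rw [deltaSeq_eq ht ht0 hN hℓ h2, mul_div_right_comm, hermiteCoeff_div hq0 hq ℓ h1 h2,
        show M - L + (M + L + ℓ) - 2 * (M - k) = 2 * k + ℓ by omega, ← pow_succ, div_div,
        div_mul_eq_mul_div, one_mul]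

/-- A chain of length one is forced to be `a_0 = L`. -/
lemma chainTotal_zero_stepSeq (hℓ : ℓ ≤ 1) (A L : ℕ) {c : ℤ} (hc : (L : ℤ) ≤ c) :
    chainTotal q (stepSeq ℓ) c 0 A ((A : ℤ) + 2 * L + ℓ) = q ^ L ^ 2 * (q ^ ℓ) ^ L := by
  have h0 : stepSeq ℓ 0 = ℓ := by
    rw [stepSeq]
    split_ifs <;> omega
  simp only [chainTotal, chainSum, h0]
  rw [Finset.sum_eq_single_of_mem (L : ℤ) (Finset.mem_Icc.2 ⟨by omega, hc⟩), if_pos rfl,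
    ← pow_mul, ← pow_add, ← zpow_natCast]
  · congr 1
    push_cast
    ring
  · intro x _ hx
    exact if_neg (by omega)

end transform

end HLBailey

theorem lemma3 {K : Type*} [Field K] [TopologicalSpace K] [T2Space K]
    (M N ℓ : ℕ) (hN : 1 ≤ N) (hℓ : ℓ ≤ N)
    (q t : K) (ht : t ^ N = q) (hq0 : q ≠ 0) (hq : ∀ j : ℕ, 1 ≤ j → q ^ j ≠ 1) :
    HLBailey.IsBaileyTransform q (q ^ ℓ)
        (HLBailey.deltaSeq q t M N ℓ) (HLBailey.gammaSeq q t M N ℓ) ∧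
      (N = 1 → ∀ L : ℕ,
        HLBailey.deltaSeq q t M N ℓ L =
            (if L ≤ M then q ^ L ^ 2 * (q ^ ℓ) ^ L / HLBailey.qPoch q q (M - L) else 0) ∧
        HLBailey.gammaSeq q t M N ℓ L =
            (if L ≤ M then q ^ L ^ 2 * (q ^ ℓ) ^ L /
              (HLBailey.qPoch q q (M - L) * HLBailey.qPoch q (q ^ ℓ * q) (M + L)) else 0)) := by
  refine ⟨HLBailey.isBaileyTransform_deltaSeq_gammaSeq ht hN hℓ hq0 hq, ?_⟩
  rintro rfl L
  have ht0 : t ≠ 0 := by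
    rintro rfl
    exact hq0 (by rw [← ht, zero_pow one_ne_zero])
  rcases lt_or_ge M L with hL | hL
  · rw [HLBailey.deltaSeq, HLBailey.gammaSeq, if_neg (by omega), if_neg (by omega),
      if_neg (by omega), if_neg (by omega)]
    exact ⟨rfl, rfl⟩
  · rw [HLBailey.deltaSeq_eq ht ht0 hN hℓ hL, HLBailey.gammaSeq_eq ht ht0 hN hℓ hL, if_pos hL,
      if_pos hL, pow_succ q ℓ]
    have h1 := HLBailey.chainTotal_zero_stepSeq (q := q) hℓ 0 L (c := (2 * M + ℓ + 1 : ℕ))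
      (by push_cast; omega)
    have h2 := HLBailey.chainTotal_zero_stepSeq (q := q) hℓ (M - L) L (c := (2 * M + ℓ + 1 : ℕ))
      (by push_cast; omega)
    rw [show ((0 : ℕ) : ℤ) + 2 * L + ℓ = (2 * L + ℓ : ℕ) by push_cast; ring] at h1
    rw [show ((M - L : ℕ) : ℤ) + 2 * L + ℓ = (M + L + ℓ : ℕ) by
      push_cast [Nat.cast_sub hL]; ring] at h2
    exact ⟨congrArg (· / _) h1, congrArg (· / _) h2⟩
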